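/- Let $L,M>0$ and let $f:[0,L]\to[0,M]$ be continuous, convex and strictly decreasing with $f(0)=M$, $f(L)=0$. Let $\Gamma$ be the graph of $f$, let $g:[0,M]\to[0,L]$ be the inverse function of $f$, and let $\operatorname{Area}(\Gamma)=\int_0^L f(x)\,dx$ be the area enclosed by $\Gamma$ and the coordinate axes. Assume $(\alpha,\beta)\in\Gamma$ is a point with $0<\alpha<L/2$, $0<\beta<M/2$ such that $f\in C^2[\alpha,L)$ with $f'<0$ and $f''>0$ on $[\alpha,L)$, and $g\in C^2[\beta,M)$ with $g'<0$ and $g''>0$ on $[\beta,M)$ (derivatives at $\alpha$ and $\beta$ being one-sided). Suppose there are partitions $\alpha=\alpha_0<\alpha_1<\dots<\alpha_m=L$ and $\beta=\beta_0<\beta_1<\dots<\beta_n=M$ such that $f''$ is monotonic on each $(\alpha_i,\alpha_{i+1})$ and $g''$ is monotonic on each $(\beta_i,\beta_{i+1})$. Suppose also that there are functions $\delta:(0,\infty)\to(0,L/2-\alpha)$ and $\epsilon:(0,\infty)\to(0,M/2-\beta)$ and constants $a_1,a_2,b_1,b_2>0$ such that, as $r\to\infty$, $$\delta(r)=O(r^{-2a_1}),\quad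 \frac1{f''(L-\delta(r))}=O(r^{1-4a_2}),\quad \epsilon(r)=O(r^{-2b_1}),\quad \frac1{g''(M-\epsilon(r))}=O(r^{1-4b_2}).$$ Put $e=\min(\tfrac16,a_1,a_2,b_1,b_2)$. For $r,s>0$ let $$\mathcal N(r,s)=\#\{(j,k)\in\mathbb Z^2: j,k\ge 0,\ js/r\le L,\ k\le rs\,f(js/r)\}$$ be the number of nonnegative-integer lattice points (those on the axes included) lying inside or on the curve $r\Gamma(s)$, the graph of $x\mapsto rs\,f(sx/r)$, and let $\mathcal S(r)$ be the set of all $s>0$ at which $s\mapsto\mathcal N(r,s)$ attains its minimum over $(0,\infty)$. Assume $L=M$. Then $\mathcal S(r)$ is nonempty for every $r>0$, and the optimal stretch factors approach $1$ as $r\to\infty$: for every $\eta>0$ one has $\mathcal S(r)\subset(1-\eta,1+\eta)$ for all sufficiently large $r$. More precisely, there is a constant $C$ such that $$\mathcal S(r)\subset\big[1-Cr^{-e},\,1+Cr^{-e}\big]\qquad\text{for all sufficiently large } r.$$ Further, $$\min_{s>0}\mathcal N(r,s)=r^2\operatorname{Area}(\Gamma)+rL+O(r^{1-2e})\qquad\text{as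 } r\to\infty.$$ -/

import Mathlib

/-- `y = f x`, `0 ≤ x ≤ L`, is a (continuous) convex, strictly decreasing curve with
intercepts `L` on the horizontal axis and `M` on the vertical axis.
(Positivity of `M` and of `f` on `[0, L)` follow.) -/
structure IsConvexDecreasingCurve (f : ℝ → ℝ) (L M : ℝ) : Prop where
  pos : 0 < L
  continuousOn : ContinuousOn f (Set.Icc 0 L)
  convexOn : ConvexOn ℝ (Set.Icc 0 L) f
  strictAntiOn : StrictAntiOn f (Set.Icc 0 L)
  left : f 0 = M
  right : f L = 0

/-- The inverse function `g : [0, M] → [0, L]` of `f : [0, L] → [0, M]`. Its values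
outside `[0, M]` play no role. -/
noncomputable def curveInverse (f : ℝ → ℝ) (L : ℝ) : ℝ → ℝ :=
  Function.invFunOn f (Set.Icc 0 L)

/-- The area enclosed by the curve and the two axes. -/
noncomputable def curveArea (f : ℝ → ℝ) (L : ℝ) : ℝ :=
  ∫ x in (0 : ℝ)..L, f x

/-- There is a partition `a = t₀ < t₁ < ⋯ < tₘ = b` such that `h` is monotonic
(increasing or decreasing) on each open subinterval `(tᵢ, tᵢ₊₁)`. -/
def IsPiecewiseMonotonic (h : ℝ → ℝ) (a b : ℝ) : Prop :=
  ∃ (m : ℕ) (t : Fin (m + 1) → ℝ), StrictMono t ∧ t 0 = a ∧ t (Fin.last m) = b ∧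
    ∀ i : Fin m, MonotoneOn h (Set.Ioo (t i.castSucc) (t i.succ)) ∨
      AntitoneOn h (Set.Ioo (t i.castSucc) (t i.succ))

/-- The second derivative of `h` on `[a, b)`, one-sided at the endpoint `a`. -/
noncomputable def secondDeriv (h : ℝ → ℝ) (a b : ℝ) : ℝ → ℝ :=
  iteratedDerivWithin 2 h (Set.Ico a b)

/-- `h ∈ C²[a, b)` with `h' < 0` and `h'' > 0` on `[a, b)`, and `h''` is piecewise monotonic
with respect to a finite partition of `[a, b]`. -/
structure IsRegularTail (h : ℝ → ℝ) (a b : ℝ) : Prop where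
  contDiffOn : ContDiffOn ℝ 2 h (Set.Ico a b)
  deriv_neg : ∀ x ∈ Set.Ico a b, derivWithin h (Set.Ico a b) x < 0
  secondDeriv_pos : ∀ x ∈ Set.Ico a b, 0 < secondDeriv h a b x
  piecewise : IsPiecewiseMonotonic (secondDeriv h a b) a b

/-- The nonnegative-integer points `(j, k)` lying inside or on the graph of
`x ↦ r s f(s x / r)`, `0 ≤ x ≤ r L / s`. -/
def closedLatticePoints (f : ℝ → ℝ) (L r s : ℝ) : Set (ℕ × ℕ) :=
  {p | (p.1 : ℝ) * s / r ≤ L ∧ (p.2 : ℝ) ≤ r * s * f ((p.1 : ℝ) * s / r)}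

theorem closedLatticePoints_finite {f : ℝ → ℝ} {L M r s : ℝ}
    (hf : IsConvexDecreasingCurve f L M) (hr : 0 < r) (hs : 0 < s) :
    (closedLatticePoints f L r s).Finite := by
  refine ((Set.finite_Iic ⌊L * r / s⌋₊).prod (Set.finite_Iic ⌊r * s * M⌋₊)).subset ?_
  rintro ⟨j, k⟩ ⟨h1, h2⟩
  have h0 : 0 ≤ (j : ℝ) * s / r := by positivity
  refine ⟨Nat.le_floor ?_, Nat.le_floor (h2.trans ?_)⟩
  · rw [le_div_iff₀ hs]
    exact (div_le_iff₀ hr).1 h1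
  · have h3 : f ((j : ℝ) * s / r) ≤ f 0 :=
      hf.strictAntiOn.antitoneOn ⟨le_rfl, hf.pos.le⟩ ⟨h0, h1⟩ h0
    rw [hf.left] at h3
    exact mul_le_mul_of_nonneg_left h3 (by positivity)

/-- The lattice point counting function of the closed first quadrant. The set that is counted
is finite by `closedLatticePoints_finite`. -/
noncomputable def closedCount (f : ℝ → ℝ) (L r s : ℝ) : ℕ :=
  (closedLatticePoints f L r s).ncard

/-- The set of stretch factors `s > 0` that minimize `s ↦ closedCount f L r s` over `(0, ∞)`. -/
def optimalStretch (f : ℝ → ℝ) (L r : ℝ) : Set ℝ :=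
  {s | 0 < s ∧ ∀ t : ℝ, 0 < t → closedCount f L r s ≤ closedCount f L r t}

/-- The minimum over `s > 0` of `closedCount f L r s` (attained, since the values are
natural numbers). -/
noncomputable def minClosedCount (f : ℝ → ℝ) (L r : ℝ) : ℕ :=
  sInf (closedCount f L r '' Set.Ioi 0)

/-! Cut the region at the point `(α, β)` of the curve: a box at the origin, the columns to its
right, and the rows above it, which are the columns of the inverse function with `1/s` in place of
`s`. A column of height `y` holds `⌊y⌋ + 1 = y + 1/2 - sawtooth y` points. By convexity and the
Lipschitz bound to the right of the cut, the sum of the heights is an integral plus a boundary term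
at the cut, up to `O(1)`. The boundary terms from columns and rows cancel against those of the box,
and what is left (`IsConvexDecreasingCurve.abs_closedCount_sub_le`) is `N(r,s) = r² Area + r(L/s +
sM)/2` up to two sawtooth sums and `O(1)`, uniformly for `s` in `[1/3, 3]`.

The sawtooth sums are treated by van der Corput's method. The sawtooth lies between one-sided
difference quotients of the second periodic Bernoulli function, whose Fourier series converges
absolutely; this reduces matters to exponential sums, bounded by the second difference test
(`second_difference_test`), itself a consequence of Kusmin–Landau. After a dyadic decomposition by
the size of the second difference (`abs_sum_sawtooth_le`), a curve with monotonic second derivative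
bounded below by `μ` costs `O(r^(2/3) + √(r/μ))`. The second derivative may degenerate at the
intercept, so the sum is cut at `L - δ(r)` and the remaining `O(rδ + 1)` columns are bounded
trivially. The hypotheses make all of this `O(r^(1-2e))`.

When `L = M`, the linear term exceeds its value at `s = 1` by `rL(s-1)²/(2s)`. A minimizer `s` does
no worse than `1`, so this excess is `O(r^(1-2e))`, hence `(s-1)² = O(r^(-2e))`. The expansion is
only available for bounded `s` and `1/s`; a lower bound for the count valid for all `s`
(`ConvexDecreasing.le_closedCount`), applied to the curve and to its inverse, places every minimizer
in `[1/3, 3]`. -/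

open Finset

/-! ### Exponential sums: the Kusmin–Landau inequality -/

/-- The additive character `x ↦ exp (2πix)`. -/
noncomputable def unitExp (x : ℝ) : ℂ := Complex.exp ((2 * Real.pi * x : ℝ) * Complex.I)

theorem norm_unitExp (x : ℝ) : ‖unitExp x‖ = 1 := Complex.norm_exp_ofReal_mul_I _

theorem unitExp_add (x y : ℝ) : unitExp (x + y) = unitExp x * unitExp y := by
  simp only [unitExp, ← Complex.exp_add]
  congr 1
  push_cast
  ring

theorem unitExp_int (k : ℤ) : unitExp k = 1 := by
  rw [unitExp, Complex.exp_eq_one_iff]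
  exact ⟨k, by push_cast; ring⟩

theorem unitExp_re (x : ℝ) : (unitExp x).re = Real.cos (2 * Real.pi * x) := by
  rw [unitExp, Complex.exp_ofReal_mul_I_re]

theorem unitExp_eq (x : ℝ) : unitExp x = ⟨Real.cos (2 * Real.pi * x), Real.sin (2 * Real.pi * x)⟩ := by
  apply Complex.ext
  · rw [unitExp, Complex.exp_ofReal_mul_I_re]
  · rw [unitExp, Complex.exp_ofReal_mul_I_im]

theorem two_mul_le_sin_pi_mul {θ t : ℝ} (hθ : 0 ≤ θ) (h1 : θ ≤ t) (h2 : t ≤ 1 - θ) :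
    2 * θ ≤ Real.sin (Real.pi * t) := by
  have hpi := Real.pi_pos
  rcases le_total t (1 / 2) with h | h
  · have := Real.mul_le_sin (x := Real.pi * t) (by nlinarith) (by nlinarith)
    have h3 : 2 / Real.pi * (Real.pi * t) = 2 * t := by field_simp
    linarith
  · have := Real.mul_le_sin (x := Real.pi * (1 - t)) (by nlinarith) (by nlinarith)
    have h3 : 2 / Real.pi * (Real.pi * (1 - t)) = 2 * (1 - t) := by field_simp
    have h4 : Real.sin (Real.pi * (1 - t)) = Real.sin (Real.pi * t) := by
      rw [mul_sub, mul_one, Real.sin_pi_sub]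
    linarith

/-- `(1 + i cot πt) / 2`, the reciprocal of `1 - exp (2πit)`. -/
noncomputable def halfCot (t : ℝ) : ℂ :=
  ⟨1 / 2, Real.cos (Real.pi * t) / Real.sin (Real.pi * t) / 2⟩

theorem halfCot_mul {t : ℝ} (h : Real.sin (Real.pi * t) ≠ 0) :
    halfCot t * (1 - unitExp t) = 1 := by
  have hc : Real.cos (2 * Real.pi * t) = 1 - 2 * Real.sin (Real.pi * t) ^ 2 := by
    rw [mul_assoc, Real.cos_two_mul, Real.cos_sq']; ring
  have hs : Real.sin (2 * Real.pi * t) = 2 * Real.sin (Real.pi * t) * Real.cos (Real.pi * t) := by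
    rw [mul_assoc, Real.sin_two_mul]
  have := Real.sin_sq_add_cos_sq (Real.pi * t)
  apply Complex.ext
  · simp only [halfCot, unitExp_eq, hc, hs, Complex.mul_re, Complex.sub_re, Complex.sub_im,
      Complex.one_re, Complex.one_im]
    field_simp
    linear_combination (2 * Real.sin (Real.pi * t)) * this
  · simp only [halfCot, unitExp_eq, hc, hs, Complex.mul_im, Complex.sub_re, Complex.sub_im,
      Complex.one_re, Complex.one_im]
    field_simp
    ring

theorem norm_halfCot_le {θ t : ℝ} (hθ : 0 < θ) (h1 : θ ≤ t) (h2 : t ≤ 1 - θ) :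
    ‖halfCot t‖ ≤ 1 / 2 + 1 / (4 * θ) ∧
      |Real.cos (Real.pi * t) / Real.sin (Real.pi * t)| ≤ 1 / (2 * θ) := by
  have hs := two_mul_le_sin_pi_mul hθ.le h1 h2
  have hc : |Real.cos (Real.pi * t) / Real.sin (Real.pi * t)| ≤ 1 / (2 * θ) := by
    rw [abs_div, abs_of_pos (by linarith : 0 < Real.sin (Real.pi * t))]
    exact div_le_div₀ zero_le_one (Real.abs_cos_le_one _) (by linarith) hs
  refine ⟨(Complex.norm_le_abs_re_add_abs_im _).trans ?_, hc⟩
  simp only [halfCot]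
  rw [abs_div, abs_div, abs_one, abs_two]
  have : 1 / (4 * θ) = 1 / (2 * θ) / 2 := by field_simp; norm_num
  linarith

/-- The real part is constant and the cotangent decreases on `(0, π)`, so the distance is a
difference of values without absolute value; along a monotone sequence such distances telescope. -/
theorem norm_halfCot_sub {s t : ℝ} (hs : 0 < s) (hst : s ≤ t) (ht : t < 1) :
    ‖halfCot t - halfCot s‖ = Real.cos (Real.pi * s) / Real.sin (Real.pi * s) / 2 -
      Real.cos (Real.pi * t) / Real.sin (Real.pi * t) / 2 := by
  have hpi := Real.pi_pos
  have h1 : 0 < Real.sin (Real.pi * s) := Real.sin_pos_of_pos_of_lt_pi (by positivity) (by nlinarith)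
  have h2 : 0 < Real.sin (Real.pi * t) :=
    Real.sin_pos_of_pos_of_lt_pi (by nlinarith) (by nlinarith)
  have h3 : 0 ≤ Real.sin (Real.pi * t - Real.pi * s) :=
    Real.sin_nonneg_of_nonneg_of_le_pi (by nlinarith) (by nlinarith)
  rw [Real.sin_sub] at h3
  have h4 : Real.cos (Real.pi * t) / Real.sin (Real.pi * t) ≤
      Real.cos (Real.pi * s) / Real.sin (Real.pi * s) := by
    rw [div_le_div_iff₀ h2 h1]; linarith
  have h5 : halfCot t - halfCot s = ((Real.cos (Real.pi * t) / Real.sin (Real.pi * t) / 2 -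
      Real.cos (Real.pi * s) / Real.sin (Real.pi * s) / 2 : ℝ) : ℂ) * Complex.I := by
    apply Complex.ext
    · simp only [halfCot, Complex.sub_re, Complex.mul_re, Complex.ofReal_re, Complex.ofReal_im,
        Complex.I_re, Complex.I_im]
      ring
    · simp only [halfCot, Complex.sub_im, Complex.mul_im, Complex.ofReal_re, Complex.ofReal_im,
        Complex.I_re, Complex.I_im]
      ring
  rw [h5, norm_mul, Complex.norm_I, mul_one, Complex.norm_real, Real.norm_eq_abs, abs_sub_comm,
    abs_of_nonneg (by linarith)]

/-- Summation by parts. Each term is `halfCot (t n)` times a difference of consecutive terms, where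
`t n` is the increment minus `k`. Since `t` is monotone, the total variation of these coefficients
is a difference of two cotangents, and all coefficients are `O(1/θ)` because `t` stays at distance
`θ` from the integers. -/
theorem kusmin_landau_Ico (x : ℕ → ℝ) {p q : ℕ} (k : ℤ) {θ : ℝ} (hθ : 0 < θ)
    (hmono : MonotoneOn (fun n => x (n + 1) - x n) (Set.Ico p q))
    (hl : ∀ n ∈ Set.Ico p q, k + θ ≤ x (n + 1) - x n)
    (hu : ∀ n ∈ Set.Ico p q, x (n + 1) - x n ≤ k + 1 - θ) :
    ‖∑ n ∈ Ico p q, unitExp (x n)‖ ≤ 2 / θ := by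
  rcases le_or_gt q p with hpq | hpq
  · rw [Ico_eq_empty_of_le hpq, sum_empty, norm_zero]; positivity
  have ht0 : ∀ n ∈ Set.Ico p q, θ ≤ x (n + 1) - x n - k := fun n hn => by linarith [hl n hn]
  have ht1 : ∀ n ∈ Set.Ico p q, x (n + 1) - x n - k ≤ 1 - θ := fun n hn => by linarith [hu n hn]
  have hθ2 : θ ≤ 1 / 2 := by linarith [ht0 p ⟨le_rfl, hpq⟩, ht1 p ⟨le_rfl, hpq⟩]
  set t : ℕ → ℝ := fun n => x (n + 1) - x n - k with ht
  have hE : ∀ n ∈ Set.Ico p q, unitExp (x n) =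
      halfCot (t n) * (unitExp (x n) - unitExp (x (n + 1))) := by
    intro n hn
    have h1 : unitExp (x (n + 1)) = unitExp (x n) * unitExp (t n) := by
      rw [← unitExp_add, ← mul_one (unitExp (x n + t n)), ← unitExp_int k, ← unitExp_add]
      congr 1
      simp only [ht]; ring
    have h2 := two_mul_le_sin_pi_mul hθ.le (ht0 n hn) (ht1 n hn)
    have h3 := halfCot_mul (t := t n) (by simp only [ht]; linarith)
    rw [h1]
    linear_combination (-unitExp (x n)) * h3
  -- The boundary term of the summation by parts is kept with the partial sum, so that each step
  -- adds exactly one difference of coefficients.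
  have key : ∀ m, p + 1 ≤ m → m ≤ q →
      ‖∑ n ∈ Ico p m, unitExp (x n) + halfCot (t (m - 1)) * unitExp (x m)‖ ≤
        ‖halfCot (t p)‖ + (Real.cos (Real.pi * t p) / Real.sin (Real.pi * t p) / 2 -
          Real.cos (Real.pi * t (m - 1)) / Real.sin (Real.pi * t (m - 1)) / 2) := by
    intro m hm
    induction m, hm using Nat.le_induction with
    | base =>
      intro _
      have h1 := hE p ⟨le_rfl, hpq⟩
      have h2 : unitExp (x p) + halfCot (t p) * unitExp (x (p + 1)) =
          halfCot (t p) * unitExp (x p) := by linear_combination h1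
      simp only [Nat.Ico_succ_singleton, sum_singleton, Nat.add_sub_cancel, sub_self, add_zero]
      rw [h2, norm_mul, norm_unitExp, mul_one]
    | succ m hm ih =>
      intro hmq
      have hm1 : m ∈ Set.Ico p q := ⟨by omega, by omega⟩
      have hm0 : m - 1 ∈ Set.Ico p q := ⟨by omega, by omega⟩
      have h1 := hE m hm1
      have h2 : ∑ n ∈ Ico p (m + 1), unitExp (x n) + halfCot (t m) * unitExp (x (m + 1)) =
          (∑ n ∈ Ico p m, unitExp (x n) + halfCot (t (m - 1)) * unitExp (x m)) +
            (halfCot (t m) - halfCot (t (m - 1))) * unitExp (x m) := by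
        rw [sum_Ico_succ_top (by omega)]
        linear_combination h1
      have h3 : t (m - 1) ≤ t m := by
        have := hmono hm0 hm1 (by omega)
        simp only [ht]
        simpa using this
      have h4 := norm_halfCot_sub (s := t (m - 1)) (t := t m) (by linarith [ht0 _ hm0]) h3
        (by linarith [ht1 _ hm1])
      rw [Nat.add_sub_cancel, h2]
      refine (norm_add_le _ _).trans ?_
      rw [norm_mul, norm_unitExp, mul_one, h4]
      linarith [ih (by omega)]
  have hq1 : q - 1 ∈ Set.Ico p q := ⟨by omega, by omega⟩
  have hp1 : p ∈ Set.Ico p q := ⟨le_rfl, hpq⟩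
  have h1 := key q hpq le_rfl
  obtain ⟨h2, h3⟩ := norm_halfCot_le hθ (ht0 p hp1) (ht1 p hp1)
  obtain ⟨h4, h5⟩ := norm_halfCot_le hθ (ht0 _ hq1) (ht1 _ hq1)
  have h6 : ‖∑ n ∈ Ico p q, unitExp (x n)‖ ≤
      ‖∑ n ∈ Ico p q, unitExp (x n) + halfCot (t (q - 1)) * unitExp (x q)‖ +
        ‖halfCot (t (q - 1))‖ := by
    have := norm_sub_le (∑ n ∈ Ico p q, unitExp (x n) + halfCot (t (q - 1)) * unitExp (x q))
      (halfCot (t (q - 1)) * unitExp (x q))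
    rwa [add_sub_cancel_right, norm_mul, norm_unitExp, mul_one] at this
  have h7 := (abs_le.1 h3).2
  have h8 := (abs_le.1 h5).1
  have h9 : 1 / (4 * θ) = (1 / θ) / 4 := by field_simp
  have h10 : 1 / (2 * θ) = (1 / θ) / 2 := by field_simp
  have h11 : 2 ≤ 1 / θ := by rw [le_div_iff₀ hθ]; linarith
  have h12 : 2 / θ = 2 * (1 / θ) := by ring
  rw [h9] at h2 h4
  rw [h10] at h7 h8
  rw [h12]
  have e1 : halfCot (t p) = halfCot (x (p + 1) - x p - k) := rfl
  have e2 : t p = x (p + 1) - x p - k := rfl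
  have e3 : t (q - 1) = x (q - 1 + 1) - x (q - 1) - k := rfl
  rw [← e2] at h2 h7
  rw [← e3] at h4 h8
  linarith

/-- Index ranges are carried as order-connected sets because the later decompositions select indices
by the value of a monotone quantity; this lemma recovers endpoints when they are needed. -/
theorem exists_eq_Ico_of_ordConnected (S : Finset ℕ) (hS : (S : Set ℕ).OrdConnected) :
    ∃ p q, S = Ico p q := by
  rcases S.eq_empty_or_nonempty with rfl | hne
  · exact ⟨0, 0, by simp⟩
  refine ⟨S.min' hne, S.max' hne + 1, ?_⟩
  ext n
  rw [mem_Ico]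
  constructor
  · intro h
    exact ⟨S.min'_le n h, Nat.lt_succ_of_le (S.le_max' n h)⟩
  · rintro ⟨h1, h2⟩
    exact hS.out (S.min'_mem hne) (S.max'_mem hne) ⟨h1, Nat.le_of_lt_succ h2⟩

theorem kusmin_landau (x : ℕ → ℝ) (S : Finset ℕ) (hS : (S : Set ℕ).OrdConnected) (k : ℤ) {θ : ℝ}
    (hθ : 0 < θ) (hmono : MonotoneOn (fun n => x (n + 1) - x n) S)
    (hl : ∀ n ∈ S, k + θ ≤ x (n + 1) - x n) (hu : ∀ n ∈ S, x (n + 1) - x n ≤ k + 1 - θ) :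
    ‖∑ n ∈ S, unitExp (x n)‖ ≤ 2 / θ := by
  obtain ⟨p, q, rfl⟩ := exists_eq_Ico_of_ordConnected S hS
  exact kusmin_landau_Ico x k hθ (by simpa using hmono) (by simpa using hl) (by simpa using hu)

/-! ### The second difference test -/

/-- The second difference of a sequence. -/
def secondDiff (x : ℕ → ℝ) (n : ℕ) : ℝ := x (n + 2) - 2 * x (n + 1) + x n

theorem ordConnected_filter_of_monotoneOn {S : Finset ℕ} (hS : (S : Set ℕ).OrdConnected)
    {φ : ℕ → ℝ} (hφ : MonotoneOn φ S) {I : Set ℝ} [DecidablePred fun n => φ n ∈ I]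
    (hI : I.OrdConnected) :
    ((S.filter fun n => φ n ∈ I : Finset ℕ) : Set ℕ).OrdConnected := by
  refine ⟨fun a ha b hb c hc => ?_⟩
  simp only [coe_filter, Set.mem_ofPred_eq] at ha hb ⊢
  have hcS : c ∈ S := hS.out ha.1 hb.1 hc
  exact ⟨hcS, hI.out ha.2 hb.2 ⟨hφ ha.1 hcS hc.1, hφ hcS hb.1 hc.2⟩⟩

theorem diff_bounds_of_secondDiff {x : ℕ → ℝ} {S : Finset ℕ} (hS : (S : Set ℕ).OrdConnected)
    {l u : ℝ} (hl : ∀ n ∈ S, l ≤ secondDiff x n) (hu : ∀ n ∈ S, secondDiff x n ≤ u)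
    {n m : ℕ} (hn : n ∈ S) (hnm : n ≤ m) (hm : m ∈ S) :
    l * ((m : ℝ) - n) ≤ (x (m + 1) - x m) - (x (n + 1) - x n) ∧
      (x (m + 1) - x m) - (x (n + 1) - x n) ≤ u * ((m : ℝ) - n) := by
  induction m, hnm using Nat.le_induction with
  | base => simp
  | succ m hnm ih =>
    have hmS : m ∈ S := hS.out hn hm ⟨hnm, Nat.le_succ m⟩
    obtain ⟨h1, h2⟩ := ih hmS
    have h3 := hl m hmS
    have h4 := hu m hmS
    simp only [secondDiff] at h3 h4
    push_cast
    constructor <;> linarith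

/-- The increments of `x` grow by at least `l` per step, so they leave a window of length `b - a`
after `(b - a) / l` steps. -/
theorem card_filter_diff_mem_Icc_le {x : ℕ → ℝ} {S : Finset ℕ}
    {l : ℝ} (hl0 : 0 < l) (hl : ∀ n ∈ S, l ≤ secondDiff x n) {T : Finset ℕ} (hTS : T ⊆ S)
    (hT : (T : Set ℕ).OrdConnected) {a b : ℝ} (hab : a ≤ b)
    (hTm : ∀ n ∈ T, x (n + 1) - x n ∈ Set.Icc a b) :
    (T.card : ℝ) ≤ (b - a) / l + 1 := by
  obtain ⟨p, q, rfl⟩ := exists_eq_Ico_of_ordConnected T hT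
  rcases le_or_gt q p with hpq | hpq
  · rw [Ico_eq_empty_of_le hpq, card_empty, Nat.cast_zero]
    have : 0 ≤ (b - a) / l := div_nonneg (by linarith) hl0.le
    linarith
  have hp : p ∈ Ico p q := mem_Ico.2 ⟨le_rfl, hpq⟩
  have hq : q - 1 ∈ Ico p q := mem_Ico.2 ⟨by omega, by omega⟩
  -- Only the lower half is wanted; the upper bound `u` is an arbitrary one, the sum of all absolute
  -- values.
  have h1 := (diff_bounds_of_secondDiff hT (fun n hn => hl n (hTS hn))
    (u := ∑ n ∈ Ico p q, |secondDiff x n|)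
    (fun n hn => (le_abs_self _).trans
      (single_le_sum (f := fun n => |secondDiff x n|) (fun _ _ => abs_nonneg _) hn))
    hp (by omega) hq).1
  have h2 := (hTm p hp).1
  have h3 := (hTm (q - 1) hq).2
  rw [Nat.card_Ico, Nat.cast_sub hpq.le, ← sub_le_iff_le_add, le_div_iff₀ hl0]
  have h4 : ((q - 1 : ℕ) : ℝ) = (q : ℝ) - 1 := by
    rw [Nat.cast_sub (by omega)]; simp
  rw [h4] at h1
  nlinarith

theorem norm_sum_unitExp_le_card (x : ℕ → ℝ) (S : Finset ℕ) :
    ‖∑ n ∈ S, unitExp (x n)‖ ≤ S.card := by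
  refine (norm_sum_le _ _).trans ?_
  simp [norm_unitExp]

/-- Van der Corput's second derivative test, for sequences. -/
theorem second_difference_test {x : ℕ → ℝ} {S : Finset ℕ} (hS : (S : Set ℕ).OrdConnected)
    {l : ℝ} (hl0 : 0 < l) (hl : ∀ n ∈ S, l ≤ secondDiff x n)
    (hu : ∀ n ∈ S, secondDiff x n ≤ 2 * l) :
    ‖∑ n ∈ S, unitExp (x n)‖ ≤ 10 * (S.card * √l + 1 / √l) := by
  classical
  have hsq : 0 < √l := Real.sqrt_pos.2 hl0
  have hsq2 : √l * √l = l := Real.mul_self_sqrt hl0.le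
  rcases S.eq_empty_or_nonempty with rfl | hne
  · simp
  -- For `√l > 1/2` counting the terms suffices. Otherwise `1/√l ≥ 2`, which absorbs additive
  -- constants below.
  rcases lt_or_ge (1 / 2) √l with hbig | hsmall
  · refine (norm_sum_unitExp_le_card x S).trans ?_
    have : 0 < 1 / √l := by positivity
    have h0 : (0 : ℝ) ≤ S.card := by positivity
    nlinarith
  set d : ℕ → ℝ := fun n => x (n + 1) - x n with hd
  have hmono : MonotoneOn d S := by
    intro n hn m hm hnm
    have := (diff_bounds_of_secondDiff hS hl hu hn hnm hm).1
    have h1 : (0 : ℝ) ≤ (m : ℝ) - n := by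
      rw [sub_nonneg]; exact_mod_cast hnm
    simp only [hd]
    nlinarith [mul_nonneg hl0.le h1]
  set a := S.min' hne
  set b := S.max' hne
  have ha : a ∈ S := S.min'_mem hne
  have hb : b ∈ S := S.max'_mem hne
  have hab : a ≤ b := S.min'_le b hb
  have hmaps : ∀ n ∈ S, ⌊d n⌋ ∈ Icc ⌊d a⌋ ⌊d b⌋ := fun n hn => mem_Icc.2
    ⟨Int.floor_le_floor (hmono ha hn (S.min'_le n hn)),
      Int.floor_le_floor (hmono hn hb (S.le_max' n hn))⟩
  -- Among the indices whose increment has integer part `k`, those within `√l` of `k` or `k + 1` are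
  -- counted trivially, at most `1/√l + 1` on each side; Kusmin–Landau with `θ = √l` gives `2/√l`
  -- for the rest. The width `√l` balances the two.
  have hfib : ∀ k : ℤ, ‖∑ n ∈ S with ⌊d n⌋ = k, unitExp (x n)‖ ≤ 5 / √l := by
    intro k
    set A := S.filter fun n => d n ∈ Set.Ico (k : ℝ) (k + √l) with hA
    set B := S.filter fun n => d n ∈ Set.Icc (k + √l) (k + 1 - √l) with hB
    set C := S.filter fun n => d n ∈ Set.Ioo (k + 1 - √l) (k + 1) with hC
    have hAo := ordConnected_filter_of_monotoneOn hS hmono (I := Set.Ico (k : ℝ) (k + √l))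
      Set.ordConnected_Ico
    have hBo := ordConnected_filter_of_monotoneOn hS hmono (I := Set.Icc (k + √l) (k + 1 - √l))
      Set.ordConnected_Icc
    have hCo := ordConnected_filter_of_monotoneOn hS hmono (I := Set.Ioo (k + 1 - √l) ((k : ℝ) + 1))
      Set.ordConnected_Ioo
    have hAB : Disjoint A B := by
      rw [Finset.disjoint_left]
      intro n h1 h2
      simp only [hA, hB, mem_filter, Set.mem_Ico, Set.mem_Icc] at h1 h2
      linarith [h1.2.2, h2.2.1]
    have hABC : Disjoint (A ∪ B) C := by
      rw [Finset.disjoint_left]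
      intro n h1 h2
      simp only [hA, hB, hC, mem_union, mem_filter, Set.mem_Ico, Set.mem_Icc, Set.mem_Ioo] at h1 h2
      rcases h1 with h1 | h1
      · linarith [h1.2.2, h2.2.1]
      · linarith [h1.2.2, h2.2.1]
    have hunion : (S.filter fun n => ⌊d n⌋ = k) = A ∪ B ∪ C := by
      ext n
      simp only [hA, hB, hC, mem_union, mem_filter, Set.mem_Ico, Set.mem_Icc, Set.mem_Ioo,
        Int.floor_eq_iff]
      constructor
      · rintro ⟨h0, h1, h2⟩
        rcases lt_or_ge (d n) (k + √l) with h3 | h3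
        · exact Or.inl (Or.inl ⟨h0, h1, h3⟩)
        rcases le_or_gt (d n) (k + 1 - √l) with h4 | h4
        · exact Or.inl (Or.inr ⟨h0, h3, h4⟩)
        · exact Or.inr ⟨h0, h4, h2⟩
      · rintro ((⟨h0, h1, h2⟩ | ⟨h0, h1, h2⟩) | ⟨h0, h1, h2⟩)
        · exact ⟨h0, h1, by linarith⟩
        · exact ⟨h0, by linarith, by linarith⟩
        · exact ⟨h0, by linarith, h2⟩
    have h1 : ‖∑ n ∈ A, unitExp (x n)‖ ≤ 1 / √l + 1 := by
      refine (norm_sum_unitExp_le_card x A).trans ?_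
      refine (card_filter_diff_mem_Icc_le hl0 hl (filter_subset _ _) hAo
        (a := k) (b := k + √l) (by linarith) ?_).trans (le_of_eq ?_)
      · intro n hn
        exact Set.Ico_subset_Icc_self (mem_filter.1 hn).2
      · rw [add_sub_cancel_left]
        congr 1
        rw [div_eq_div_iff hl0.ne' hsq.ne', one_mul, hsq2]
    have h2 : ‖∑ n ∈ C, unitExp (x n)‖ ≤ 1 / √l + 1 := by
      refine (norm_sum_unitExp_le_card x C).trans ?_
      refine (card_filter_diff_mem_Icc_le hl0 hl (filter_subset _ _) hCo
        (a := k + 1 - √l) (b := k + 1) (by linarith) ?_).trans (le_of_eq ?_)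
      · intro n hn
        exact Set.Ioo_subset_Icc_self (mem_filter.1 hn).2
      · rw [sub_sub_cancel]
        congr 1
        rw [div_eq_div_iff hl0.ne' hsq.ne', one_mul, hsq2]
    have h3 : ‖∑ n ∈ B, unitExp (x n)‖ ≤ 2 / √l :=
      kusmin_landau x B hBo k hsq (hmono.mono (coe_subset.2 (filter_subset _ _)))
        (fun n hn => (mem_filter.1 hn).2.1) (fun n hn => (mem_filter.1 hn).2.2)
    have h4 : 2 ≤ 1 / √l := by rw [le_div_iff₀ hsq]; linarith
    rw [hunion, sum_union hABC, sum_union hAB]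
    have h5 : 5 / √l = 5 * (1 / √l) := by ring
    have h6 : 2 / √l = 2 * (1 / √l) := by ring
    rw [h5]
    rw [h6] at h3
    refine (norm_add₃_le).trans ?_
    linarith
  rw [← sum_fiberwise_of_maps_to hmaps]
  refine (norm_sum_le _ _).trans ?_
  refine (sum_le_sum fun k _ => hfib k).trans ?_
  rw [sum_const, nsmul_eq_mul]
  -- Increments grow by at most `2l` per step, which limits the number of integer parts that occur.
  have hcard : ((Icc ⌊d a⌋ ⌊d b⌋).card : ℝ) ≤ 2 * l * S.card + 2 := by
    have h1 : ⌊d a⌋ ≤ ⌊d b⌋ := (mem_Icc.1 (hmaps a ha)).2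
    have h2 := (diff_bounds_of_secondDiff hS hl hu ha hab hb).2
    have h3 : (b : ℝ) - a ≤ S.card := by
      have : Icc a b ⊆ S := fun n hn => hS.out ha hb (by simpa using hn)
      have h4 := card_le_card this
      rw [Nat.card_Icc] at h4
      have h5 : b ≤ S.card + a := by omega
      rw [sub_le_iff_le_add]
      exact_mod_cast h5
    rw [Int.card_Icc]
    have h6 : (((⌊d b⌋ + 1 - ⌊d a⌋).toNat : ℤ) : ℝ) = ⌊d b⌋ + 1 - ⌊d a⌋ := by
      rw [Int.toNat_of_nonneg (by omega)]
      push_cast; ring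
    rw [Int.cast_natCast] at h6
    rw [h6]
    have h7 := Int.floor_le (d b)
    have h8 := Int.lt_floor_add_one (d a)
    have h9 : d b - d a ≤ 2 * l * ((b : ℝ) - a) := h2
    nlinarith
  have h10 : (2 * l * S.card + 2) * (5 / √l) = 10 * (S.card * √l + 1 / √l) := by
    nth_rewrite 1 [← hsq2]
    field_simp
    ring
  rw [← h10]
  exact mul_le_mul_of_nonneg_right hcard (by positivity)

/-! ### Sawtooth sums by van der Corput's method -/

/-- The sawtooth function `x - ⌊x⌋ - 1/2`. -/
noncomputable def sawtooth (x : ℝ) : ℝ := Int.fract x - 1 / 2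

/-- The second Bernoulli polynomial, extended periodically from `[0, 1)`. -/
noncomputable def periodicBernoulliTwo (x : ℝ) : ℝ := Int.fract x ^ 2 - Int.fract x + 1 / 6

theorem abs_sawtooth_le (x : ℝ) : |sawtooth x| ≤ 1 / 2 := by
  have h1 := Int.fract_nonneg x
  have h2 := Int.fract_lt_one x
  rw [sawtooth, abs_le]
  constructor <;> linarith

/-- The derivative of the periodic Bernoulli function is twice the sawtooth, so the quotient is the
mean of the sawtooth over `[x - η, x]`. Without a jump this mean is `sawtooth x - η/2`; a jump only
raises it, since values before the jump are larger. The companion lower bound uses `[x, x + η]`. -/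
theorem sawtooth_le {η : ℝ} (hη : 0 < η) (hη1 : η ≤ 1) (x : ℝ) :
    sawtooth x ≤ η / 2 - 1 / (2 * η) * (periodicBernoulliTwo (x + -η) - periodicBernoulliTwo x) := by
  have h0 := Int.fract_nonneg x
  have h1 := Int.fract_lt_one x
  have h2 : 0 < 1 / η := by positivity
  have h3 : 1 / (2 * η) = (1 / η) / 2 := by field_simp
  have h4 : η * (1 / η) = 1 := by field_simp
  rcases le_or_gt η (Int.fract x) with h | h
  · have : Int.fract (x + -η) = Int.fract x - η := by
      rw [Int.fract_eq_iff]
      refine ⟨by linarith, by linarith, ⌊x⌋, ?_⟩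
      rw [← Int.self_sub_floor]; ring
    rw [sawtooth, periodicBernoulliTwo, periodicBernoulliTwo, this, h3]
    apply le_of_eq
    linear_combination (-Int.fract x + η / 2 + 1 / 2) * h4
  · have : Int.fract (x + -η) = Int.fract x - η + 1 := by
      rw [Int.fract_eq_iff]
      refine ⟨by linarith, by linarith, ⌊x⌋ - 1, ?_⟩
      rw [← Int.self_sub_floor]; push_cast; ring
    rw [sawtooth, periodicBernoulliTwo, periodicBernoulliTwo, this, h3]
    have h5 : 0 ≤ (η - Int.fract x) * (1 / η) := mul_nonneg (by linarith) h2.le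
    nlinarith [congrArg (fun z => z * Int.fract x) h4, congrArg (fun z => z * η) h4]

theorem le_sawtooth {η : ℝ} (hη : 0 < η) (hη1 : η ≤ 1) (x : ℝ) :
    1 / (2 * η) * (periodicBernoulliTwo (x + η) - periodicBernoulliTwo x) - η / 2 ≤ sawtooth x := by
  have h0 := Int.fract_nonneg x
  have h1 := Int.fract_lt_one x
  have h2 : 0 < 1 / η := by positivity
  have h3 : 1 / (2 * η) = (1 / η) / 2 := by field_simp
  have h4 : η * (1 / η) = 1 := by field_simp
  rcases lt_or_ge (Int.fract x + η) 1 with h | h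
  · have : Int.fract (x + η) = Int.fract x + η := by
      rw [Int.fract_eq_iff]
      refine ⟨by linarith, by linarith, ⌊x⌋, ?_⟩
      rw [← Int.self_sub_floor]; ring
    rw [sawtooth, periodicBernoulliTwo, periodicBernoulliTwo, this, h3]
    apply le_of_eq
    linear_combination (Int.fract x + η / 2 - 1 / 2) * h4
  · have : Int.fract (x + η) = Int.fract x + η - 1 := by
      rw [Int.fract_eq_iff]
      refine ⟨by linarith, by linarith, ⌊x⌋ + 1, ?_⟩
      rw [← Int.self_sub_floor]; push_cast; ring
    rw [sawtooth, periodicBernoulliTwo, periodicBernoulliTwo, this, h3]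
    have h5 : 0 ≤ (Int.fract x + η - 1) * (1 / η) := mul_nonneg (by linarith) h2.le
    nlinarith [congrArg (fun z => z * Int.fract x) h4, congrArg (fun z => z * η) h4]

/-- Coefficients of size `1/h²` make the series absolutely convergent, unlike that of the sawtooth.
The term `h = 0` is zero because division by zero gives zero. -/
theorem hasSum_periodicBernoulliTwo (x : ℝ) :
    HasSum (fun h : ℕ => 1 / (Real.pi ^ 2 * (h : ℝ) ^ 2) * (unitExp (h * x)).re)
      (periodicBernoulliTwo x) := by
  have h1 := hasSum_one_div_nat_pow_mul_cos (k := 1) one_ne_zero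
    (x := Int.fract x) ⟨Int.fract_nonneg x, (Int.fract_lt_one x).le⟩
  have h2 := bernoulliFun_two (Int.fract x)
  rw [bernoulliFun] at h2
  rw [mul_one, h2] at h1
  have h3 := h1.mul_left (1 / Real.pi ^ 2)
  have h5 : 1 / Real.pi ^ 2 * ((-1 : ℝ) ^ (1 + 1) * (2 * Real.pi) ^ 2 / 2 / (Nat.factorial 2 : ℝ) *
      (Int.fract x ^ 2 - Int.fract x + 6⁻¹)) = periodicBernoulliTwo x := by
    rw [periodicBernoulliTwo]
    have := Real.pi_pos
    simp only [Nat.factorial]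
    field_simp
    norm_num
  rw [h5] at h3
  refine h3.congr_fun fun h => ?_
  have h4 : Real.cos (2 * Real.pi * h * Int.fract x) = Real.cos (2 * Real.pi * (h * x)) := by
    rw [← Int.self_sub_floor, ← Real.cos_sub_int_mul_two_pi (2 * Real.pi * (h * x)) ((h : ℤ) * ⌊x⌋)]
    congr 1
    push_cast
    ring
  rw [unitExp_re, h4, ← one_div_mul_one_div, mul_assoc]

theorem norm_unitExp_sub_one_le (x : ℝ) : ‖unitExp x - 1‖ ≤ 2 * Real.pi * min 1 |x| := by
  have hpi := Real.two_le_pi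
  rcases le_total 1 |x| with h | h
  · rw [min_eq_left h]
    refine (norm_sub_le _ _).trans ?_
    rw [norm_unitExp, norm_one]
    linarith
  · rw [min_eq_right h]
    have := Real.norm_exp_I_mul_ofReal_sub_one_le (x := 2 * Real.pi * x)
    rw [unitExp, mul_comm _ Complex.I]
    refine this.trans (le_of_eq ?_)
    rw [Real.norm_eq_abs, abs_mul, abs_of_pos (by linarith)]

/-- A shift by `τ` multiplies the `h`-th Fourier mode by `unitExp (h * τ)`; subtracting leaves a
factor of norm at most `2π min(1, h|τ|)`. A bound on all partial sums passes to the limit. -/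
theorem abs_sum_periodicBernoulliTwo_le (y : ℕ → ℝ) (S : Finset ℕ) {τ c : ℝ}
    (hc : ∀ m : ℕ, ∑ h ∈ range m, 2 * Real.pi * min 1 (h * |τ|) / (Real.pi ^ 2 * (h : ℝ) ^ 2) *
      ‖∑ n ∈ S, unitExp (h * y n)‖ ≤ c) :
    |∑ n ∈ S, (periodicBernoulliTwo (y n + τ) - periodicBernoulliTwo (y n))| ≤ c := by
  have h1 := hasSum_sum (s := S) fun n _ =>
    (hasSum_periodicBernoulliTwo (y n + τ)).sub (hasSum_periodicBernoulliTwo (y n))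
  refine le_of_tendsto h1.tendsto_sum_nat.abs (Filter.Eventually.of_forall fun m => ?_)
  refine le_trans ?_ (hc m)
  refine (abs_sum_le_sum_abs _ _).trans (sum_le_sum fun h _ => ?_)
  have h2 : ∑ n ∈ S, (1 / (Real.pi ^ 2 * (h : ℝ) ^ 2) * (unitExp (h * (y n + τ))).re -
      1 / (Real.pi ^ 2 * (h : ℝ) ^ 2) * (unitExp (h * y n)).re) =
      1 / (Real.pi ^ 2 * (h : ℝ) ^ 2) *
        ((unitExp (h * τ) - 1) * ∑ n ∈ S, unitExp (h * y n)).re := by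
    rw [mul_sum, Complex.re_sum, mul_sum]
    refine sum_congr rfl fun n _ => ?_
    rw [mul_add, unitExp_add, ← mul_sub, ← Complex.sub_re]
    congr 2
    ring
  rw [h2, abs_mul, abs_of_nonneg (by positivity)]
  have h3 : |((unitExp (h * τ) - 1) * ∑ n ∈ S, unitExp (h * y n)).re| ≤
      2 * Real.pi * min 1 (h * |τ|) * ‖∑ n ∈ S, unitExp (h * y n)‖ := by
    refine (Complex.abs_re_le_norm _).trans ?_
    rw [norm_mul]
    refine mul_le_mul_of_nonneg_right ?_ (norm_nonneg _)
    have := norm_unitExp_sub_one_le (h * τ)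
    rwa [abs_mul, Nat.abs_cast] at this
  calc _ ≤ 1 / (Real.pi ^ 2 * (h : ℝ) ^ 2) *
      (2 * Real.pi * min 1 (h * |τ|) * ‖∑ n ∈ S, unitExp (h * y n)‖) :=
        mul_le_mul_of_nonneg_left h3 (by positivity)
    _ = _ := by ring

/-- The terms are `h^(-1/2)/H` up to `H` and `h^(-3/2)` beyond. Comparison with differences of
`2√h/H` and of `-2/√h` gives the two regimes of the inductive bound, which agree at `m = H`. -/
theorem sum_min_one_mul_sqrt_le {H : ℕ} (hH : 0 < H) (m : ℕ) :
    ∑ h ∈ range m, min 1 (h * (1 / (H : ℝ))) / (h : ℝ) ^ 2 * √h ≤ 4 / √H := by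
  have hH0 : (0 : ℝ) < H := by exact_mod_cast hH
  have hsH : 0 < √(H : ℝ) := Real.sqrt_pos.2 hH0
  have hsH2 : √(H : ℝ) * √H = H := Real.mul_self_sqrt hH0.le
  have key : ∀ m : ℕ, ∑ h ∈ range (m + 1), min 1 (h * (1 / (H : ℝ))) / (h : ℝ) ^ 2 * √h ≤
      if m ≤ H then 2 * √m / H else 4 / √H - 2 / √m := by
    intro m
    induction m with
    | zero => simp
    | succ m ih =>
      rw [sum_range_succ]
      have hb : 0 < √((m + 1 : ℕ) : ℝ) := Real.sqrt_pos.2 (by positivity)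
      have ha : 0 ≤ √(m : ℝ) := Real.sqrt_nonneg _
      have hb2 : √((m + 1 : ℕ) : ℝ) * √((m + 1 : ℕ) : ℝ) = m + 1 := by
        rw [Real.mul_self_sqrt (by positivity)]; push_cast; ring
      have ha2 : √(m : ℝ) * √m = m := Real.mul_self_sqrt (by positivity)
      have hab : √(m : ℝ) ≤ √((m + 1 : ℕ) : ℝ) := Real.sqrt_le_sqrt (by push_cast; linarith)
      have hm1 : ((m + 1 : ℕ) : ℝ) = √((m + 1 : ℕ) : ℝ) * √((m + 1 : ℕ) : ℝ) := by
        rw [hb2]; push_cast; ring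
      set b := √((m + 1 : ℕ) : ℝ) with hbdef
      set a := √(m : ℝ) with hadef
      have hgap : 1 ≤ 2 * b * (b - a) := by nlinarith
      rcases le_or_gt (m + 1) H with h | h
      · rw [if_pos (by omega)] at ih
        rw [if_pos h]
        have hle : ((m + 1 : ℕ) : ℝ) ≤ H := by exact_mod_cast h
        have h1 : min 1 (((m + 1 : ℕ) : ℝ) * (1 / (H : ℝ))) = ((m + 1 : ℕ) : ℝ) * (1 / (H : ℝ)) := by
          apply min_eq_right
          rw [mul_one_div, div_le_one hH0]; exact hle
        rw [h1, hm1]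
        have h2 : b * b * (1 / (H : ℝ)) / (b * b) ^ 2 * b = (1 / b) / H := by
          field_simp
        have h3 : 1 / b ≤ 2 * b - 2 * a := by
          rw [div_le_iff₀ hb]; linarith
        have h4 : (1 / b) / H ≤ (2 * b - 2 * a) / H := by gcongr
        rw [h2]
        rw [sub_div] at h4
        linarith
      · rw [if_neg (by omega)]
        have hle : (H : ℝ) ≤ ((m + 1 : ℕ) : ℝ) := by exact_mod_cast h.le
        have h1 : min 1 (((m + 1 : ℕ) : ℝ) * (1 / (H : ℝ))) = 1 := by
          apply min_eq_left
          rw [mul_one_div, le_div_iff₀ hH0]; linarith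
        have ha0 : 0 < a := Real.sqrt_pos.2 (by
          have : 0 < m := by omega
          exact_mod_cast this)
        have h2 : 1 / (b * b) ^ 2 * b = 1 / (b * b * b) := by field_simp
        have h3 : 1 / (b * b * b) ≤ 2 / a - 2 / b := by
          rw [div_sub_div _ _ ha0.ne' hb.ne', div_le_div_iff₀ (by positivity) (by positivity)]
          have h5 : a * b ≤ b * b := mul_le_mul_of_nonneg_right hab hb.le
          have h6 : (a * b) * 1 ≤ (b * b) * (2 * b * (b - a)) :=
            mul_le_mul h5 hgap zero_le_one (by positivity)
          linarith
        have h4 : ∑ h ∈ range (m + 1), min 1 (h * (1 / (H : ℝ))) / (h : ℝ) ^ 2 * √h ≤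
            4 / √H - 2 / a := by
          rcases eq_or_lt_of_le (Nat.lt_succ_iff.1 h) with h7 | h7
          · rw [if_pos h7.ge] at ih
            refine ih.trans (le_of_eq ?_)
            rw [hadef, ← h7]
            nth_rewrite 2 [← hsH2]
            field_simp
            norm_num
          · rw [if_neg (by omega)] at ih
            exact ih
        rw [h1, hm1, h2]
        linarith
  rcases m with _ | m
  · rw [range_zero, sum_empty]; positivity
  refine (key m).trans ?_
  split_ifs with h
  · have h1 : √(m : ℝ) ≤ √H := Real.sqrt_le_sqrt (by exact_mod_cast h)
    rw [div_le_div_iff₀ hH0 hsH]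
    nlinarith
  · have : 0 ≤ 2 / √(m : ℝ) := by positivity
    linarith

theorem secondDiff_const_mul (c : ℝ) (x : ℕ → ℝ) (n : ℕ) :
    secondDiff (fun n => c * x n) n = c * secondDiff x n := by
  simp only [secondDiff]; ring

theorem sum_min_norm_sum_unitExp_le {x : ℕ → ℝ} {S : Finset ℕ} (hS : (S : Set ℕ).OrdConnected)
    {d : ℝ} (hd : 0 < d) (hl : ∀ n ∈ S, d ≤ secondDiff x n) (hu : ∀ n ∈ S, secondDiff x n ≤ 2 * d)
    {H : ℕ} (hH : 0 < H) (m : ℕ) :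
    ∑ h ∈ range m, 2 * Real.pi * min 1 (h * (1 / (H : ℝ))) / (Real.pi ^ 2 * (h : ℝ) ^ 2) *
      ‖∑ n ∈ S, unitExp (h * x n)‖ ≤ 28 * (S.card * √d / √H + 1 / √d / H) := by
  have hH0 : (0 : ℝ) < H := by exact_mod_cast hH
  have hpi := Real.pi_pos
  have hsd : 0 < √d := Real.sqrt_pos.2 hd
  -- The second difference test is applied to `h * x` with `l = h * d`, and `10 * (2/π) ≤ 7`. In the
  -- part with `1/√(h d)` the minimum is replaced by `h/H`; what remains is the series with `H = 1`,
  -- so the previous lemma serves twice.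
  have hterm : ∀ h ∈ range m, 2 * Real.pi * min 1 (h * (1 / (H : ℝ))) / (Real.pi ^ 2 * (h : ℝ) ^ 2) *
      ‖∑ n ∈ S, unitExp (h * x n)‖ ≤
      7 * (S.card * √d * (min 1 (h * (1 / (H : ℝ))) / (h : ℝ) ^ 2 * √h) +
        1 / √d / H * (min 1 (h * (1 / ((1 : ℕ) : ℝ))) / (h : ℝ) ^ 2 * √h)) := by
    intro h _
    rcases Nat.eq_zero_or_pos h with rfl | hh
    · simp
    have hh0 : (0 : ℝ) < h := by exact_mod_cast hh
    have hh1 : (1 : ℝ) ≤ h := by exact_mod_cast hh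
    have hsh : 0 < √(h : ℝ) := Real.sqrt_pos.2 hh0
    have hsh2 : √(h : ℝ) * √h = h := Real.mul_self_sqrt hh0.le
    have h1 := second_difference_test (x := fun n => h * x n) hS (l := h * d) (by positivity)
      (fun n hn => by
        rw [secondDiff_const_mul]; exact mul_le_mul_of_nonneg_left (hl n hn) hh0.le)
      (fun n hn => by
        rw [secondDiff_const_mul]; nlinarith [mul_le_mul_of_nonneg_left (hu n hn) hh0.le])
    rw [Real.sqrt_mul hh0.le] at h1
    set μ := min 1 (h * (1 / (H : ℝ))) with hμ
    have hμ0 : 0 ≤ μ := le_min zero_le_one (by positivity)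
    have h2 : min 1 (h * (1 / ((1 : ℕ) : ℝ))) = 1 := by
      rw [Nat.cast_one, div_one, mul_one]; exact min_eq_left hh1
    rw [h2]
    have h3 : 2 * Real.pi * μ / (Real.pi ^ 2 * (h : ℝ) ^ 2) = 2 / Real.pi * (μ / (h : ℝ) ^ 2) := by
      field_simp
    have h4 : 2 / Real.pi ≤ 7 / 10 := by
      rw [div_le_div_iff₀ hpi (by norm_num)]
      nlinarith [Real.pi_gt_d2]
    have h5 : μ / (h : ℝ) ^ 2 * (1 / (√h * √d)) ≤ 1 / √d / H * (1 / (h : ℝ) ^ 2 * √h) := by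
      have h6 : μ ≤ h * (1 / (H : ℝ)) := min_le_right _ _
      have h7 : 1 / √d / H * (1 / (h : ℝ) ^ 2 * √h) =
          (h * (1 / (H : ℝ))) / (h : ℝ) ^ 2 * (1 / (√h * √d)) := by
        have : (h : ℝ) * (1 / √h) = √h := by rw [mul_one_div, div_eq_iff hsh.ne', hsh2]
        calc _ = 1 / √d / H * (1 / (h : ℝ) ^ 2 * (h * (1 / √h))) := by rw [this]
          _ = _ := by field_simp
      rw [h7]
      gcongr
    have h8 : 0 ≤ μ / (h : ℝ) ^ 2 := by positivity
    calc 2 * Real.pi * μ / (Real.pi ^ 2 * (h : ℝ) ^ 2) * ‖∑ n ∈ S, unitExp (h * x n)‖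
        ≤ 7 / 10 * (μ / (h : ℝ) ^ 2) * (10 * (S.card * (√h * √d) + 1 / (√h * √d))) := by
          rw [h3]
          gcongr
      _ = 7 * (S.card * √d * (μ / (h : ℝ) ^ 2 * √h) + μ / (h : ℝ) ^ 2 * (1 / (√h * √d))) := by ring
      _ ≤ _ := by gcongr
  refine (sum_le_sum hterm).trans ?_
  rw [← mul_sum, sum_add_distrib, ← mul_sum, ← mul_sum]
  have h1 := sum_min_one_mul_sqrt_le hH m
  have h2 := sum_min_one_mul_sqrt_le one_pos m
  rw [Nat.cast_one, Real.sqrt_one] at h2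
  have h3 : S.card * √d * ∑ h ∈ range m, min 1 (h * (1 / (H : ℝ))) / (h : ℝ) ^ 2 * √h ≤
      S.card * √d * (4 / √H) := mul_le_mul_of_nonneg_left h1 (by positivity)
  have h4 : 1 / √d / H * ∑ h ∈ range m, min 1 (h * (1 / ((1 : ℕ) : ℝ))) / (h : ℝ) ^ 2 * √h ≤
      1 / √d / H * (4 / 1) := by
    rw [Nat.cast_one]
    exact mul_le_mul_of_nonneg_left h2 (by positivity)
  have h5 : S.card * √d * (4 / √H) = 4 * (S.card * √d / √H) := by ring
  linarith

theorem abs_sum_sawtooth_le_of_nat {x : ℕ → ℝ} {S : Finset ℕ} (hS : (S : Set ℕ).OrdConnected)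
    {d : ℝ} (hd : 0 < d) (hl : ∀ n ∈ S, d ≤ secondDiff x n) (hu : ∀ n ∈ S, secondDiff x n ≤ 2 * d)
    {H : ℕ} (hH : 0 < H) :
    |∑ n ∈ S, sawtooth (x n)| ≤
      S.card / H + 14 * (S.card * √d * √H + 1 / √d) := by
  have hH0 : (0 : ℝ) < H := by exact_mod_cast hH
  have hη0 : 0 < 1 / (H : ℝ) := by positivity
  have hη1 : 1 / (H : ℝ) ≤ 1 := by
    rw [div_le_one hH0]; exact_mod_cast hH
  have hsH : 0 < √(H : ℝ) := Real.sqrt_pos.2 hH0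
  have hsH2 : √(H : ℝ) * √H = H := Real.mul_self_sqrt hH0.le
  have h1 := abs_sum_periodicBernoulliTwo_le x S (τ := 1 / (H : ℝ))
    (by rw [abs_of_pos hη0]; exact sum_min_norm_sum_unitExp_le hS hd hl hu hH)
  have h2 := abs_sum_periodicBernoulliTwo_le x S (τ := -(1 / (H : ℝ)))
    (by rw [abs_neg, abs_of_pos hη0]; exact sum_min_norm_sum_unitExp_le hS hd hl hu hH)
  have h3 := sum_le_sum fun n (_ : n ∈ S) => sawtooth_le hη0 hη1 (x n)
  have h4 := sum_le_sum fun n (_ : n ∈ S) => le_sawtooth hη0 hη1 (x n)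
  rw [sum_sub_distrib, ← mul_sum, sum_const, nsmul_eq_mul] at h3 h4
  have h5 : 1 / (2 * (1 / (H : ℝ))) = H / 2 := by field_simp
  rw [h5] at h3 h4
  have h6 : (H : ℝ) / 2 * (28 * (S.card * √d / √H + 1 / √d / H)) =
      14 * (S.card * √d * √H + 1 / √d) := by
    have : (H : ℝ) * (S.card * √d / √H) = S.card * √d * √H := by
      rw [mul_div_assoc', div_eq_iff hsH.ne', mul_assoc _ √(H : ℝ), hsH2, mul_comm]
    have h7 : (H : ℝ) * (1 / √d / H) = 1 / √d := by field_simp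
    linear_combination 14 * this + 14 * h7
  have h7 : S.card * (1 / (H : ℝ) / 2) ≤ S.card / H := by
    rw [div_div, mul_one_div]; gcongr; linarith
  have h8 := abs_le.1 h1
  have h9 := abs_le.1 h2
  rw [abs_le]
  have h10 : 0 < (H : ℝ) / 2 := by positivity
  constructor
  · have := mul_le_mul_of_nonneg_left h8.1 h10.le
    linarith
  · have := mul_le_mul_of_nonneg_left h9.1 h10.le
    linarith

/-- The choice `H ≈ d^(-1/3)` balances `|S|/H` against `|S| √d √H`. -/
theorem abs_sum_sawtooth_le_of_dyadic {x : ℕ → ℝ} {S : Finset ℕ} (hS : (S : Set ℕ).OrdConnected)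
    {d : ℝ} (hd : 0 < d) (hd1 : d ≤ 1) (hl : ∀ n ∈ S, d ≤ secondDiff x n)
    (hu : ∀ n ∈ S, secondDiff x n ≤ 2 * d) :
    |∑ n ∈ S, sawtooth (x n)| ≤ 30 * (S.card * d ^ (1 / 3 : ℝ) + 1 / √d) := by
  -- The sixth root turns `d^(1/3)` and `√d` into integral powers of `w`.
  obtain ⟨w, hw0, hw⟩ : ∃ w : ℝ, 0 < w ∧ d = w ^ 6 :=
    ⟨d ^ (1 / 6 : ℝ), by positivity, by
      rw [← Real.rpow_natCast, ← Real.rpow_mul hd.le]; norm_num⟩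
  have hw1 : w ≤ 1 := by
    by_contra h
    have : 1 < w ^ 6 := one_lt_pow₀ (not_le.1 h) (by norm_num)
    linarith
  have hsd : √d = w ^ 3 := by
    rw [hw, show w ^ 6 = (w ^ 3) ^ 2 by ring, Real.sqrt_sq (by positivity)]
  have hrd : d ^ (1 / 3 : ℝ) = w ^ 2 := by
    rw [hw, ← Real.rpow_natCast, ← Real.rpow_natCast, ← Real.rpow_mul hw0.le]; norm_num
  set H := ⌈(w ^ 2)⁻¹⌉₊ with hHdef
  have hw2 : 0 < (w ^ 2)⁻¹ := by positivity
  have hw21 : 1 ≤ (w ^ 2)⁻¹ := (one_le_inv₀ (by positivity)).2 (pow_le_one₀ hw0.le hw1)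
  have hH : 0 < H := Nat.ceil_pos.2 hw2
  have h1 := abs_sum_sawtooth_le_of_nat hS hd hl hu hH
  have hH1 : (w ^ 2)⁻¹ ≤ H := Nat.le_ceil _
  have hH2 : (H : ℝ) ≤ 4 * (w ^ 2)⁻¹ := by linarith [Nat.ceil_lt_add_one hw2.le]
  have h2 : √(H : ℝ) ≤ 2 * w⁻¹ := by
    rw [Real.sqrt_le_left (by positivity)]
    rw [mul_pow, inv_pow]; linarith
  have h3 : (S.card : ℝ) / H ≤ S.card * w ^ 2 := by
    rw [div_eq_mul_inv]
    gcongr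
    exact inv_le_of_inv_le₀ (by positivity) hH1
  have h4 : (S.card : ℝ) * w ^ 3 * √H ≤ 2 * (S.card * w ^ 2) := by
    calc (S.card : ℝ) * w ^ 3 * √H ≤ S.card * w ^ 3 * (2 * w⁻¹) := by gcongr
      _ = _ := by field_simp
  rw [hsd] at h1 ⊢
  rw [hrd]
  have h5 : 0 ≤ 1 / w ^ 3 := by positivity
  have h6 : 0 ≤ (S.card : ℝ) * w ^ 2 := by positivity
  linarith

/-- Van der Corput's estimate of a sawtooth sum over a sequence with monotonic second differences. -/
theorem abs_sum_sawtooth_le {x : ℕ → ℝ} {d : ℝ} (hd : 0 < d) {S : Finset ℕ}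
    (hS : (S : Set ℕ).OrdConnected) (hl : ∀ n ∈ S, d ≤ secondDiff x n)
    (hmono : MonotoneOn (secondDiff x) S ∨ AntitoneOn (secondDiff x) S) :
    |∑ n ∈ S, sawtooth (x n)| ≤ 30 * ∑ n ∈ S, secondDiff x n ^ (1 / 3 : ℝ) + 120 / √d := by
  classical
  induction hN : S.card using Nat.strong_induction_on generalizing S d with
  | _ N ih =>
    rcases S.eq_empty_or_nonempty with rfl | hne
    · rw [sum_empty, sum_empty, abs_zero, mul_zero, zero_add]; positivity
    -- Let `c` be the least second difference. The indices with value in `[c, 2c)` form one dyadic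
    -- class; those remaining are fewer and satisfy the induction hypothesis with `2c` in place of
    -- `d`.
    obtain ⟨n₀, hn₀, hmin⟩ := S.exists_min_image (secondDiff x) hne
    set c := secondDiff x n₀ with hc
    have hdc : d ≤ c := hl n₀ hn₀
    have hc0 : 0 < c := hd.trans_le hdc
    rcases lt_or_ge 1 c with hc1 | hc1
    · have h1 : |∑ n ∈ S, sawtooth (x n)| ≤ ∑ n ∈ S, secondDiff x n ^ (1 / 3 : ℝ) := by
        refine (abs_sum_le_sum_abs _ _).trans (sum_le_sum fun n hn => ?_)
        have h2 : 1 ≤ secondDiff x n ^ (1 / 3 : ℝ) :=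
          Real.one_le_rpow (hc1.le.trans (hmin n hn)) (by norm_num)
        linarith [abs_sawtooth_le (x n)]
      have h3 : 0 ≤ ∑ n ∈ S, secondDiff x n ^ (1 / 3 : ℝ) := (abs_nonneg _).trans h1
      have h4 : 0 ≤ 120 / √d := by positivity
      linarith
    have hfil : ∀ I : Set ℝ, I.OrdConnected →
        ((S.filter fun n => secondDiff x n ∈ I : Finset ℕ) : Set ℕ).OrdConnected := by
      intro I hI
      rcases hmono with h | h
      · exact ordConnected_filter_of_monotoneOn hS h hI
      · have h1 := ordConnected_filter_of_monotoneOn hS h.neg (I := -I) (by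
          refine ⟨fun a ha b hb y hy => ?_⟩
          rw [Set.mem_neg] at ha hb ⊢
          exact hI.out hb ha ⟨by linarith [hy.2], by linarith [hy.1]⟩)
        simpa using h1
    set A := S.filter fun n => secondDiff x n ∈ Set.Iio (2 * c) with hA
    set B := S.filter fun n => secondDiff x n ∈ Set.Ici (2 * c) with hB
    have hAo := hfil (Set.Iio (2 * c)) Set.ordConnected_Iio
    have hBo := hfil (Set.Ici (2 * c)) Set.ordConnected_Ici
    have hBS : B ⊆ S := filter_subset _ _
    have hAS : A ⊆ S := filter_subset _ _
    have hsplit : ∀ φ : ℕ → ℝ, ∑ n ∈ S, φ n = ∑ n ∈ A, φ n + ∑ n ∈ B, φ n := by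
      intro φ
      rw [← sum_filter_add_sum_filter_not S (fun n => secondDiff x n ∈ Set.Iio (2 * c))]
      simp only [hA, hB, Set.mem_Iio, Set.mem_Ici, not_lt]
    have hBlt : B.card < N := by
      rw [← hN]
      refine card_lt_card ((ssubset_iff_of_subset hBS).2 ⟨n₀, hn₀, fun h => ?_⟩)
      have := (mem_filter.1 h).2
      rw [Set.mem_Ici] at this
      linarith
    have h1 := ih B.card hBlt (S := B) (d := 2 * c) (by positivity) hBo
      (fun n hn => (mem_filter.1 hn).2)
      (hmono.imp (fun h => h.mono (coe_subset.2 hBS)) (fun h => h.mono (coe_subset.2 hBS))) rfl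
    have h2 := abs_sum_sawtooth_le_of_dyadic (x := x) (S := A) hAo hc0 hc1 (fun n hn => hmin n (hAS hn))
      (fun n hn => (mem_filter.1 hn).2.le)
    have h3 : A.card * c ^ (1 / 3 : ℝ) ≤ ∑ n ∈ A, secondDiff x n ^ (1 / 3 : ℝ) := by
      rw [← nsmul_eq_mul]
      refine card_nsmul_le_sum _ _ _ fun n hn => ?_
      exact Real.rpow_le_rpow hc0.le (hmin n (hAS hn)) (by norm_num)
    -- The constant 120 closes the geometric recursion: `120/√2 ≤ 90` leaves 30 for the class just
    -- removed.
    have h4 : 120 / √(2 * c) + 30 / √c ≤ 120 / √c := by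
      have hs : 0 < √c := Real.sqrt_pos.2 hc0
      have h2s : (4 / 3 : ℝ) ≤ √2 := Real.le_sqrt_of_sq_le (by norm_num)
      rw [Real.sqrt_mul zero_le_two]
      have : 120 / (√2 * √c) ≤ 90 / √c := by
        rw [div_le_div_iff₀ (by positivity) hs]
        nlinarith
      have h6 : 120 / √c = 90 / √c + 30 / √c := by rw [← add_div]; norm_num
      linarith
    have h5 : 120 / √c ≤ 120 / √d := by gcongr
    rw [hsplit, hsplit]
    refine (abs_add_le _ _).trans ?_
    have h6 : 30 / √c = 30 * (1 / √c) := by ring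
    linarith

/-! ### Sawtooth sums along a regular tail -/

theorem IsRegularTail.hasDerivAt {h : ℝ → ℝ} {a b : ℝ} (H : IsRegularTail h a b) {x : ℝ}
    (hx : x ∈ Set.Ioo a b) : HasDerivAt h (derivWithin h (Set.Ico a b) x) x :=
  ((H.contDiffOn.differentiableOn (by norm_num)) x
    (Set.Ioo_subset_Ico_self hx)).hasDerivWithinAt.hasDerivAt
      (Ico_mem_nhds hx.1 hx.2)

theorem IsRegularTail.hasDerivAt_derivWithin {h : ℝ → ℝ} {a b : ℝ} (H : IsRegularTail h a b)
    {x : ℝ} (hx : x ∈ Set.Ioo a b) :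
    HasDerivAt (derivWithin h (Set.Ico a b)) (secondDeriv h a b x) x := by
  have h1 := H.contDiffOn.differentiableOn_iteratedDerivWithin (m := 1) (by norm_num)
    (uniqueDiffOn_Ico a b) x (Set.Ioo_subset_Ico_self hx)
  have h2 := h1.hasDerivWithinAt.hasDerivAt (Ico_mem_nhds hx.1 hx.2)
  rw [secondDeriv, iteratedDerivWithin_succ]
  rw [iteratedDerivWithin_one] at h2 ⊢
  exact h2

theorem IsRegularTail.continuousOn_secondDeriv {h : ℝ → ℝ} {a b : ℝ} (H : IsRegularTail h a b) :
    ContinuousOn (secondDeriv h a b) (Set.Ico a b) :=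
  H.contDiffOn.continuousOn_iteratedDerivWithin le_rfl (uniqueDiffOn_Ico a b)

theorem mul_sq_le_second_difference {h h1 h2 : ℝ → ℝ} {c d : ℝ}
    (hd1 : ∀ x ∈ Set.Ioo c d, HasDerivAt h (h1 x) x)
    (hd2 : ∀ x ∈ Set.Ioo c d, HasDerivAt h1 (h2 x) x) {y u m : ℝ} (hu : 0 < u) (hy : c < y)
    (hyd : y + 2 * u < d) (hm : ∀ x ∈ Set.Ioo y (y + 2 * u), m ≤ h2 x) :
    m * u ^ 2 ≤ h (y + 2 * u) - 2 * h (y + u) + h y := by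
  have hφ : ∀ x ∈ Set.Icc y (y + u), HasDerivAt (fun z => h (z + u) - h z) (h1 (x + u) - h1 x) x := by
    intro x hx
    exact ((hd1 (x + u) ⟨by linarith [hx.1], by linarith [hx.2]⟩).comp_add_const x u).sub
      (hd1 x ⟨by linarith [hx.1], by linarith [hx.2]⟩)
  obtain ⟨ξ, hξ, e1⟩ := exists_hasDerivAt_eq_slope (fun z => h (z + u) - h z)
    (fun x => h1 (x + u) - h1 x) (a := y) (b := y + u) (by linarith)
    (fun x hx => (hφ x hx).continuousAt.continuousWithinAt)
    (fun x hx => hφ x (Set.Ioo_subset_Icc_self hx))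
  obtain ⟨ζ, hζ, e2⟩ := exists_hasDerivAt_eq_slope h1 h2 (a := ξ) (b := ξ + u) (by linarith)
    (fun x hx => (hd2 x ⟨by linarith [hx.1, hξ.1], by linarith [hx.2, hξ.2]⟩).continuousAt.continuousWithinAt)
    (fun x hx => hd2 x ⟨by linarith [hx.1, hξ.1], by linarith [hx.2, hξ.2]⟩)
  have h3 := hm ζ ⟨by linarith [hζ.1, hξ.1], by linarith [hζ.2, hξ.2]⟩
  rw [add_sub_cancel_left, eq_div_iff hu.ne'] at e1 e2
  rw [← e2, show y + u + u = y + 2 * u by ring] at e1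
  nlinarith [mul_le_mul_of_nonneg_right h3 (sq_nonneg u)]

/-- No third derivative is needed: the derivative of the second difference in `y` is a difference of
two increments of `h1` over adjacent intervals, hence `u` times a difference of values of `h2` at
ordered points. -/
theorem monotoneOn_second_difference {h h1 h2 : ℝ → ℝ} {c d : ℝ}
    (hd1 : ∀ x ∈ Set.Ioo c d, HasDerivAt h (h1 x) x)
    (hd2 : ∀ x ∈ Set.Ioo c d, HasDerivAt h1 (h2 x) x) (hm : MonotoneOn h2 (Set.Ioo c d))
    {u : ℝ} (hu : 0 < u) :
    MonotoneOn (fun y => h (y + 2 * u) - 2 * h (y + u) + h y) (Set.Ioo c (d - 2 * u)) := by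
  have hD : ∀ y ∈ Set.Ioo c (d - 2 * u), HasDerivAt (fun y => h (y + 2 * u) - 2 * h (y + u) + h y)
      (h1 (y + 2 * u) - 2 * h1 (y + u) + h1 y) y := by
    intro y hy
    exact (((hd1 _ ⟨by linarith [hy.1], by linarith [hy.2]⟩).comp_add_const y (2 * u)).sub
      (((hd1 _ ⟨by linarith [hy.1], by linarith [hy.2]⟩).comp_add_const y u).const_mul 2)).add
      (hd1 y ⟨hy.1, by linarith [hy.2]⟩)
  refine monotoneOn_of_deriv_nonneg (convex_Ioo _ _)
    (fun y hy => (hD y hy).continuousAt.continuousWithinAt)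
    (fun y hy => (hD y (interior_subset hy)).differentiableAt.differentiableWithinAt) ?_
  intro y hy
  have hy := interior_subset hy
  rw [(hD y hy).deriv]
  obtain ⟨ξ, hξ, e1⟩ := exists_hasDerivAt_eq_slope h1 h2 (a := y) (b := y + u) (by linarith)
    (fun x hx => (hd2 x ⟨by linarith [hx.1, hy.1], by linarith [hx.2, hy.2]⟩).continuousAt.continuousWithinAt)
    (fun x hx => hd2 x ⟨by linarith [hx.1, hy.1], by linarith [hx.2, hy.2]⟩)
  obtain ⟨ζ, hζ, e2⟩ := exists_hasDerivAt_eq_slope h1 h2 (a := y + u) (b := y + 2 * u) (by linarith)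
    (fun x hx => (hd2 x ⟨by linarith [hx.1, hy.1], by linarith [hx.2, hy.2]⟩).continuousAt.continuousWithinAt)
    (fun x hx => hd2 x ⟨by linarith [hx.1, hy.1], by linarith [hx.2, hy.2]⟩)
  have h3 := hm (a := ξ) (b := ζ) ⟨by linarith [hξ.1, hy.1], by linarith [hξ.2, hy.2]⟩
    ⟨by linarith [hζ.1, hy.1], by linarith [hζ.2, hy.2]⟩ (by linarith [hζ.1, hξ.2])
  rw [e1, e2, show y + u - y = u by ring, show y + 2 * u - (y + u) = u by ring,
    div_le_div_iff_of_pos_right hu] at h3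
  linarith

theorem antitoneOn_second_difference {h h1 h2 : ℝ → ℝ} {c d : ℝ}
    (hd1 : ∀ x ∈ Set.Ioo c d, HasDerivAt h (h1 x) x)
    (hd2 : ∀ x ∈ Set.Ioo c d, HasDerivAt h1 (h2 x) x) (hm : AntitoneOn h2 (Set.Ioo c d))
    {u : ℝ} (hu : 0 < u) :
    AntitoneOn (fun y => h (y + 2 * u) - 2 * h (y + u) + h y) (Set.Ioo c (d - 2 * u)) := by
  have := monotoneOn_second_difference (h := -h) (h1 := -h1) (h2 := -h2)
    (fun x hx => (hd1 x hx).neg) (fun x hx => (hd2 x hx).neg) hm.neg hu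
  intro x hx y hy hxy
  have := this hx hy hxy
  simp only [Pi.neg_apply] at this
  simp only
  linarith

/-- Away from `b` compactness bounds the second derivative below. On the last piece of the partition
it either increases, and the same bound persists, or decreases, and its value at `y` is a bound to
the left of `y`. Thus the single value at the cut-off controls the whole range `[a, y]`. -/
theorem IsRegularTail.exists_secondDeriv_bound {h : ℝ → ℝ} {a b : ℝ} (H : IsRegularTail h a b)
    (hab : a < b) : ∃ c > 0, ∀ x y, a ≤ x → x ≤ y → y < b →
      c ≤ secondDeriv h a b x ∨ secondDeriv h a b y ≤ secondDeriv h a b x := by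
  obtain ⟨m, t, ht, ht0, htm, hmono⟩ := H.piecewise
  rcases Nat.eq_zero_or_pos m with rfl | hm
  · have : t 0 = t (Fin.last 0) := rfl
    linarith
  obtain ⟨m, rfl⟩ := Nat.exists_eq_succ_of_ne_zero hm.ne'
  have h1 := hmono (Fin.last m)
  rw [show (Fin.last m).succ = Fin.last (m + 1) from rfl, htm] at h1
  set p := t (Fin.last m).castSucc
  have hpb : p < b := by rw [← htm]; exact ht (Fin.castSucc_lt_last _)
  have hap : a ≤ p := by rw [← ht0]; exact ht.monotone (Fin.zero_le _)
  set q := (p + b) / 2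
  have hpq : p < q := by simp only [q]; linarith
  have hqb : q < b := by simp only [q]; linarith
  obtain ⟨z, hz, hmin⟩ := isCompact_Icc.exists_isMinOn (s := Set.Icc a q)
    ⟨a, le_rfl, by linarith⟩ (H.continuousOn_secondDeriv.mono (Set.Icc_subset_Ico_right hqb))
  refine ⟨secondDeriv h a b z, H.secondDeriv_pos z ⟨hz.1, by linarith [hz.2]⟩, ?_⟩
  intro x y hax hxy hyb
  rcases le_or_gt x q with hxq | hxq
  · exact Or.inl (hmin ⟨hax, hxq⟩)
  · rcases h1 with h1 | h1
    · exact Or.inl ((hmin ⟨by linarith, le_rfl⟩).trans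
        (h1 ⟨hpq, hqb⟩ ⟨by linarith, by linarith⟩ hxq.le))
    · exact Or.inr (h1 ⟨by linarith, by linarith⟩ ⟨by linarith, hyb⟩ hxy)

theorem card_le_of_forall_mem_Icc {T : Finset ℕ} {u v : ℝ} (huv : u ≤ v)
    (hT : ∀ n ∈ T, (n : ℝ) ∈ Set.Icc u v) : (T.card : ℝ) ≤ v - u + 1 := by
  rcases T.eq_empty_or_nonempty with rfl | hne
  · rw [card_empty, Nat.cast_zero]; linarith
  have h1 : T ⊆ Icc (T.min' hne) (T.max' hne) := fun n hn =>
    mem_Icc.2 ⟨T.min'_le n hn, T.le_max' n hn⟩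
  have h2 := card_le_card h1
  have h3 := T.min'_le _ (T.max'_mem hne)
  rw [Nat.card_Icc] at h2
  have h4 : T.card + T.min' hne ≤ T.max' hne + 1 := by omega
  have h5 : (T.card : ℝ) + T.min' hne ≤ T.max' hne + 1 := by exact_mod_cast h4
  linarith [(hT _ (T.min'_mem hne)).1, (hT _ (T.max'_mem hne)).2]

theorem sum_Ico_secondDiff (x : ℕ → ℝ) {p q : ℕ} (hpq : p ≤ q) :
    ∑ n ∈ Ico p q, secondDiff x n = (x (q + 1) - x q) - (x (p + 1) - x p) := by
  induction q, hpq using Nat.le_induction with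
  | base => simp
  | succ q hq ih =>
    rw [sum_Ico_succ_top hq, ih, secondDiff]; ring

theorem secondDiff_scaled (h : ℝ → ℝ) (r s : ℝ) (n : ℕ) :
    secondDiff (fun n : ℕ => r * s * h (n * s / r)) n =
      r * s * (h (n * s / r + 2 * (s / r)) - 2 * h (n * s / r + s / r) + h (n * s / r)) := by
  simp only [secondDiff]
  push_cast
  rw [show ((n : ℝ) + 2) * s / r = n * s / r + 2 * (s / r) by ring,
    show ((n : ℝ) + 1) * s / r = n * s / r + s / r by ring]
  ring

/-- The sawtooth sum over an interval on which the second derivative is monotonic. -/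
theorem IsRegularTail.abs_sum_sawtooth_piece_le {h : ℝ → ℝ} {a b : ℝ} (H : IsRegularTail h a b)
    (hb : 0 ≤ b) {K : ℝ} (hK0 : 0 ≤ K)
    (hK : ∀ x ∈ Set.Icc a b, ∀ y ∈ Set.Icc a b, |h x - h y| ≤ K * |x - y|)
    {c d : ℝ} (hac : a ≤ c) (hdb : d ≤ b)
    (hmono : MonotoneOn (secondDeriv h a b) (Set.Ioo c d) ∨
      AntitoneOn (secondDeriv h a b) (Set.Ioo c d))
    {r s μ : ℝ} (hr : 1 ≤ r) (hs : 1 / 3 ≤ s) (hs3 : s ≤ 3) (hμ : 0 < μ) {S : Finset ℕ}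
    (hS : (S : Set ℕ).OrdConnected)
    (hSm : ∀ n ∈ S, c < n * s / r ∧ n * s / r + 2 * (s / r) < d)
    (hSμ : ∀ n ∈ S, ∀ x ∈ Set.Ioo (n * s / r) (n * s / r + 2 * (s / r)),
      μ ≤ secondDeriv h a b x) :
    |∑ n ∈ S, sawtooth (r * s * h (n * s / r))| ≤
      30 * (3 * b + 1 + 18 * K) * r ^ (2 / 3 : ℝ) + 720 * √r * √(1 / μ) := by
  have hr0 : 0 < r := by linarith
  have hs0 : 0 < s := by linarith
  have hu : 0 < s / r := by positivity
  set x : ℕ → ℝ := fun n => r * s * h (n * s / r) with hx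
  have hd1 : ∀ z ∈ Set.Ioo c d, HasDerivAt h (derivWithin h (Set.Ico a b) z) z := fun z hz =>
    H.hasDerivAt ⟨hac.trans_lt hz.1, hz.2.trans_le hdb⟩
  have hd2 : ∀ z ∈ Set.Ioo c d, HasDerivAt (derivWithin h (Set.Ico a b)) (secondDeriv h a b z) z :=
    fun z hz => H.hasDerivAt_derivWithin ⟨hac.trans_lt hz.1, hz.2.trans_le hdb⟩
  have hlow : ∀ n ∈ S, s ^ 3 / r * μ ≤ secondDiff x n := by
    intro n hn
    rw [hx, secondDiff_scaled]
    have h1 := mul_sq_le_second_difference hd1 hd2 hu (hSm n hn).1 (hSm n hn).2 (hSμ n hn)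
    calc s ^ 3 / r * μ = r * s * (μ * (s / r) ^ 2) := by field_simp
      _ ≤ _ := mul_le_mul_of_nonneg_left h1 (by positivity)
  have hmem : ∀ n ∈ S, (n : ℝ) * s / r ∈ Set.Ioo c (d - 2 * (s / r)) := fun n hn =>
    ⟨(hSm n hn).1, by linarith [(hSm n hn).2]⟩
  have hle : ∀ n m : ℕ, n ≤ m → (n : ℝ) * s / r ≤ m * s / r := by
    intro n m hnm
    have : (n : ℝ) ≤ m := by exact_mod_cast hnm
    gcongr
  have hmono' : MonotoneOn (secondDiff x) S ∨ AntitoneOn (secondDiff x) S := by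
    refine hmono.imp (fun hm => ?_) (fun hm => ?_)
    · intro n hn m hm' hnm
      rw [hx, secondDiff_scaled, secondDiff_scaled]
      exact mul_le_mul_of_nonneg_left
        (monotoneOn_second_difference hd1 hd2 hm hu (hmem n hn) (hmem m hm') (hle n m hnm))
        (by positivity)
    · intro n hn m hm' hnm
      rw [hx, secondDiff_scaled, secondDiff_scaled]
      exact mul_le_mul_of_nonneg_left
        (antitoneOn_second_difference hd1 hd2 hm hu (hmem n hn) (hmem m hm') (hle n m hnm))
        (by positivity)
  have hdpos : 0 < s ^ 3 / r * μ := by positivity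
  have key := abs_sum_sawtooth_le hdpos hS hlow hmono'
  refine key.trans (add_le_add ?_ ?_)
  · obtain ⟨p, q, rfl⟩ := exists_eq_Ico_of_ordConnected S hS
    rcases le_or_gt q p with hpq | hpq
    · rw [Ico_eq_empty_of_le hpq, sum_empty, mul_zero]
      positivity
    have hp : p ∈ Ico p q := mem_Ico.2 ⟨le_rfl, hpq⟩
    have hq : q - 1 ∈ Ico p q := mem_Ico.2 ⟨by omega, by omega⟩
    -- First differences are at most `s² K ≤ 9K`, so the second differences, which telescope, have
    -- sum at most `18K`.
    have hstep : ∀ n : ℕ, a ≤ n * s / r → ((n + 1 : ℕ) : ℝ) * s / r ≤ b →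
        |x (n + 1) - x n| ≤ 9 * K := by
      intro n h1 h2
      have h3 : (n : ℝ) * s / r ≤ ((n + 1 : ℕ) : ℝ) * s / r := hle n (n + 1) (Nat.le_succ n)
      have h4 := hK _ ⟨h1.trans h3, h2⟩ _ ⟨h1, h3.trans h2⟩
      have h5 : ((n + 1 : ℕ) : ℝ) * s / r - n * s / r = s / r := by push_cast; ring
      rw [h5, abs_of_pos hu] at h4
      have h6 : x (n + 1) - x n = r * s * (h (((n + 1 : ℕ) : ℝ) * s / r) - h (n * s / r)) := by
        simp only [hx]; ring
      rw [h6, abs_mul, abs_of_pos (by positivity)]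
      calc r * s * |h (((n + 1 : ℕ) : ℝ) * s / r) - h (n * s / r)| ≤ r * s * (K * (s / r)) := by
            gcongr
        _ = s ^ 2 * K := by field_simp
        _ ≤ 9 * K := by
            have : s ^ 2 ≤ 9 := by nlinarith
            gcongr
    have hsum : ∑ n ∈ Ico p q, secondDiff x n ≤ 18 * K := by
      rw [sum_Ico_secondDiff x hpq.le]
      have hbq := (hSm _ hq).2
      have haq := (hSm _ hq).1
      have hbp := (hSm _ hp).2
      have hap := (hSm _ hp).1
      have hq1 : ((q - 1 : ℕ) : ℝ) = q - 1 := by rw [Nat.cast_sub (by omega)]; simp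
      rw [hq1] at hbq haq
      have e1 : ((q : ℝ) - 1) * s / r = q * s / r - s / r := by ring
      have e2 : ((q + 1 : ℕ) : ℝ) * s / r = q * s / r + s / r := by push_cast; ring
      have e3 : ((p + 1 : ℕ) : ℝ) * s / r = p * s / r + s / r := by push_cast; ring
      have h1 := hstep q (by linarith) (by linarith)
      have h2 := hstep p (by linarith) (by linarith)
      linarith [(abs_le.1 h1).2, (abs_le.1 h2).1]
    have hcard : ((Ico p q).card : ℝ) ≤ r * (3 * b + 1) := by
      rw [Nat.card_Ico, Nat.cast_sub hpq.le]
      have h1 := (hSm _ hq).2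
      have hq1 : ((q - 1 : ℕ) : ℝ) = q - 1 := by rw [Nat.cast_sub (by omega)]; simp
      rw [hq1] at h1
      have h2 : ((q : ℝ) - 1) * s / r ≤ b := by linarith
      rw [div_le_iff₀ hr0] at h2
      have h3 : (0 : ℝ) ≤ (q : ℝ) - 1 := by
        rw [← hq1]; positivity
      have h4 : (0 : ℝ) ≤ p := by positivity
      nlinarith [mul_le_mul_of_nonneg_left hs h3]
    -- In place of Hölder: `t^(1/3) ≤ 1 + t` at `t = r * secondDiff x n`. With `O(r)` indices and
    -- second differences of bounded sum, this gives `r^(-1/3) * O(r)`.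
    have hterm : ∀ n ∈ Ico p q, secondDiff x n ^ (1 / 3 : ℝ) ≤
        r ^ (-(1 / 3) : ℝ) * (1 + r * secondDiff x n) := by
      intro n hn
      have h1 : 0 ≤ secondDiff x n := hdpos.le.trans (hlow n hn)
      have h2 : ∀ t : ℝ, 0 ≤ t → t ^ (1 / 3 : ℝ) ≤ 1 + t := by
        intro t ht
        rcases le_total t 1 with ht1 | ht1
        · linarith [Real.rpow_le_one ht ht1 (by norm_num : (0 : ℝ) ≤ 1 / 3)]
        · have := Real.rpow_le_rpow_of_exponent_le ht1 (by norm_num : (1 / 3 : ℝ) ≤ 1)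
          rw [Real.rpow_one] at this
          linarith
      have h3 : secondDiff x n ^ (1 / 3 : ℝ) =
          r ^ (-(1 / 3) : ℝ) * (r * secondDiff x n) ^ (1 / 3 : ℝ) := by
        rw [Real.mul_rpow hr0.le h1, ← mul_assoc, ← Real.rpow_add hr0]
        norm_num
      rw [h3]
      exact mul_le_mul_of_nonneg_left (h2 _ (by positivity)) (by positivity)
    have h4 : r ^ (2 / 3 : ℝ) = r ^ (-(1 / 3) : ℝ) * r := by
      nth_rewrite 3 [← Real.rpow_one r]
      rw [← Real.rpow_add hr0]
      norm_num
    have h5 : ∑ n ∈ Ico p q, secondDiff x n ^ (1 / 3 : ℝ) ≤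
        r ^ (-(1 / 3) : ℝ) * (r * (3 * b + 1) + r * (18 * K)) := by
      refine (sum_le_sum hterm).trans ?_
      rw [← mul_sum, sum_add_distrib, ← mul_sum, sum_const, nsmul_eq_mul, mul_one]
      gcongr
    rw [h4]
    linarith
  · have h1 : 1 / √(s ^ 3 / r * μ) = √r * √(1 / s ^ 3) * √(1 / μ) := by
      rw [← Real.sqrt_mul hr0.le, ← Real.sqrt_mul (by positivity), one_div, ← Real.sqrt_inv]
      congr 1
      field_simp
    have h2 : √(1 / s ^ 3) ≤ 6 := by
      rw [Real.sqrt_le_left (by norm_num), div_le_iff₀ (by positivity)]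
      have : (1 / 3 : ℝ) ^ 3 ≤ s ^ 3 := pow_le_pow_left₀ (by norm_num) hs 3
      linarith
    calc 120 / √(s ^ 3 / r * μ) = 120 * (√r * √(1 / s ^ 3) * √(1 / μ)) := by rw [← h1]; ring
      _ ≤ 120 * (√r * 6 * √(1 / μ)) := by gcongr
      _ = _ := by ring

theorem sqrt_add_le_add (x y : ℝ) (hx : 0 ≤ x) (hy : 0 ≤ y) : √(x + y) ≤ √x + √y := by
  rw [Real.sqrt_le_left (by positivity)]
  nlinarith [Real.sq_sqrt hx, Real.sq_sqrt hy, Real.sqrt_nonneg x, Real.sqrt_nonneg y,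
    mul_nonneg (Real.sqrt_nonneg x) (Real.sqrt_nonneg y)]

/-- The sawtooth sum over the whole tail, cut off at `y`. -/
theorem IsRegularTail.exists_abs_sum_sawtooth_le {h : ℝ → ℝ} {a b : ℝ} (H : IsRegularTail h a b)
    (ha : 0 ≤ a) (hab : a < b) {K : ℝ} (hK0 : 0 ≤ K)
    (hK : ∀ x ∈ Set.Icc a b, ∀ y ∈ Set.Icc a b, |h x - h y| ≤ K * |x - y|) :
    ∃ C, 0 ≤ C ∧ ∀ r s y : ℝ, 1 ≤ r → 1 / 3 ≤ s → s ≤ 3 → a < y → y < b →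
      |∑ n ∈ Ioc ⌊r * a / s⌋₊ ⌊r * b / s⌋₊, sawtooth (r * s * h (n * s / r))| ≤
        C * (r ^ (2 / 3 : ℝ) + √r * √(1 / secondDeriv h a b y) + r * (b - y)) := by
  classical
  obtain ⟨c, hc0, hc⟩ := H.exists_secondDeriv_bound hab
  obtain ⟨m, t, ht, ht0, htm, hmono⟩ := H.piecewise
  have hb0 : 0 < b := by linarith
  set A := 30 * (3 * b + 1 + 18 * K) with hA
  have hA0 : 0 ≤ A := by positivity
  refine ⟨m * (A + 720 * √(1 / c) + 720) + (3 * m + 10), by positivity, ?_⟩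
  intro r s y hr hs hs3 hay hyb
  have hr0 : 0 < r := by linarith
  have hs0 : 0 < s := by linarith
  have hu : 0 < s / r := by positivity
  have hy0 : 0 < secondDeriv h a b y := H.secondDeriv_pos y ⟨hay.le, hyb⟩
  set T := Ioc ⌊r * a / s⌋₊ ⌊r * b / s⌋₊ with hT
  have hTmem : ∀ n ∈ T, a < n * s / r ∧ n * s / r ≤ b := by
    intro n hn
    rw [hT, mem_Ioc, Nat.floor_lt (by positivity), Nat.le_floor_iff (by positivity)] at hn
    rw [lt_div_iff₀ hr0, div_le_iff₀ hr0]
    rw [div_lt_iff₀ hs0, le_div_iff₀ hs0] at hn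
    constructor <;> linarith [hn.1, hn.2]
  -- The second difference at `n` reads three sample points; all three must lie in one piece of the
  -- partition and not beyond `y`.
  set S : Fin m → Finset ℕ := fun i => T.filter fun n => t i.castSucc < n * s / r ∧
    n * s / r + 2 * (s / r) < t i.succ ∧ n * s / r + 2 * (s / r) ≤ y with hSdef
  have hle : ∀ n m : ℕ, n ≤ m → (n : ℝ) * s / r ≤ m * s / r := by
    intro n m hnm
    have : (n : ℝ) ≤ m := by exact_mod_cast hnm
    gcongr
  set μ := min c (secondDeriv h a b y) with hμdef
  have hμ0 : 0 < μ := lt_min hc0 hy0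
  have hμ : √(1 / μ) ≤ √(1 / c) + √(1 / secondDeriv h a b y) := by
    refine le_trans (Real.sqrt_le_sqrt ?_) (sqrt_add_le_add _ _ (by positivity) (by positivity))
    have h1 : 0 < 1 / c := by positivity
    have h2 : 0 < 1 / secondDeriv h a b y := by positivity
    rcases min_choice c (secondDeriv h a b y) with h3 | h3 <;> rw [hμdef, h3] <;> linarith
  have hta : ∀ i, a ≤ t i := fun i => by rw [← ht0]; exact ht.monotone (Fin.zero_le _)
  have htb : ∀ i, t i ≤ b := fun i => by rw [← htm]; exact ht.monotone (Fin.le_last _)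
  have hr23 : 1 ≤ r ^ (2 / 3 : ℝ) := Real.one_le_rpow hr (by norm_num)
  have hsr : √r ≤ r ^ (2 / 3 : ℝ) := by
    rw [Real.sqrt_eq_rpow]
    exact Real.rpow_le_rpow_of_exponent_le hr (by norm_num)
  have hpiece : ∀ i, |∑ n ∈ S i, sawtooth (r * s * h (n * s / r))| ≤
      A * r ^ (2 / 3 : ℝ) + 720 * √r * √(1 / μ) := by
    intro i
    refine H.abs_sum_sawtooth_piece_le hb0.le hK0 hK (hta _) (htb _) (hmono i) hr hs hs3 hμ0
      ?_ ?_ ?_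
    · refine ⟨fun n hn k hk l hl => ?_⟩
      simp only [hSdef, coe_filter, Set.mem_ofPred_eq] at hn hk ⊢
      have h1 := hle n l hl.1
      have h2 := hle l k hl.2
      refine ⟨?_, by linarith [hn.2.1], by linarith [hk.2.2.1], by linarith [hk.2.2.2]⟩
      rw [hT, mem_Ioc] at hn hk ⊢
      exact ⟨hn.1.1.trans_le hl.1, hl.2.trans hk.1.2⟩
    · intro n hn
      have := (mem_filter.1 hn).2
      exact ⟨this.1, this.2.1⟩
    · intro n hn z hz
      have h1 := (mem_filter.1 hn).2
      have h2 := hTmem n (mem_filter.1 hn).1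
      rcases hc z y (by linarith [hz.1]) (by linarith [hz.2, h1.2.2]) hyb with h3 | h3
      · exact (min_le_left _ _).trans h3
      · exact (min_le_right _ _).trans h3
  set U := univ.biUnion S with hU
  have hUT : U ⊆ T := by
    rw [hU, biUnion_subset]
    exact fun i _ => filter_subset _ _
  have hdisj : ∀ i j : Fin m, i < j → Disjoint (S i) (S j) := by
    intro i j hij
    rw [Finset.disjoint_left]
    intro n hi hj
    have h1 := (mem_filter.1 hi).2.2.1
    have h2 := (mem_filter.1 hj).2.1
    have h3 : t i.succ ≤ t j.castSucc := ht.monotone (Fin.succ_le_castSucc_iff.2 hij)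
    linarith
  have hUsum : |∑ n ∈ U, sawtooth (r * s * h (n * s / r))| ≤
      m * (A * r ^ (2 / 3 : ℝ) + 720 * √r * √(1 / μ)) := by
    rw [hU, sum_biUnion (fun i _ j _ hij => by
      rcases lt_or_gt_of_ne hij with h1 | h1
      · exact hdisj i j h1
      · exact (hdisj j i h1).symm)]
    refine (abs_sum_le_sum_abs _ _).trans ((sum_le_sum fun i _ => hpiece i).trans ?_)
    rw [sum_const, card_univ, Fintype.card_fin, nsmul_eq_mul]
  have hconv : ∀ z : ℝ, ∀ n : ℕ, (n : ℝ) * s / r ≤ z ↔ (n : ℝ) ≤ z * r / s := by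
    intro z n
    rw [div_le_iff₀ hr0, le_div_iff₀ hs0]
  set E : Finset ℕ := (T.filter fun n : ℕ => y < n * s / r + 2 * (s / r)) ∪
    univ.biUnion fun i : Fin (m + 1) => T.filter fun n : ℕ =>
      (n : ℝ) * s / r ≤ t i ∧ t i ≤ n * s / r + 2 * (s / r) with hE
  -- If the window of `n` neither passes `y` nor meets a partition point, then by induction along
  -- the partition `n` would lie to the right of every `t i`, including the last, `b`.
  have hrest : T \ U ⊆ E := by
    intro n hn
    rw [mem_sdiff] at hn
    obtain ⟨hnT, hnU⟩ := hn
    rw [hE, mem_union, mem_filter, mem_biUnion]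
    by_contra! hcon
    have hcon1 := hcon.1 hnT
    have hcon2 : ∀ i, n * s / r ≤ t i → n * s / r + 2 * (s / r) < t i := by
      intro i hi
      by_contra! h3
      exact hcon.2 i (mem_univ _) (mem_filter.2 ⟨hnT, hi, h3⟩)
    have hall : ∀ i : Fin (m + 1), t i < n * s / r := by
      intro i
      induction i using Fin.induction with
      | zero => rw [ht0]; exact (hTmem n hnT).1
      | succ i ih =>
        by_contra! h3
        exact hnU (mem_biUnion.2 ⟨i, mem_univ _, mem_filter.2 ⟨hnT, ih, hcon2 _ h3, hcon1⟩⟩)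
    have := hall (Fin.last m)
    rw [htm] at this
    linarith [(hTmem n hnT).2]
  -- A point is met by the windows of at most three indices; beyond `y` there are at most `r(b -
  -- y)/s + 3` indices, and `1/s ≤ 3`.
  have hcardE : (E.card : ℝ) ≤ 3 * r * (b - y) + 3 + (m + 1) * 3 := by
    have h1 : ((T.filter fun n : ℕ => y < n * s / r + 2 * (s / r)).card : ℝ) ≤
        b * r / s - (y * r / s - 2) + 1 := by
      refine card_le_of_forall_mem_Icc ?_ ?_
      · have : y * r / s ≤ b * r / s := by gcongr
        linarith
      · intro n hn
        obtain ⟨h2, h3⟩ := mem_filter.1 hn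
        refine ⟨?_, (hconv b n).1 (hTmem n h2).2⟩
        rw [sub_le_iff_le_add, div_le_iff₀ hs0]
        have h4 : (n : ℝ) * s / r + 2 * (s / r) = (n + 2) * s / r := by ring
        rw [h4, lt_div_iff₀ hr0] at h3
        exact h3.le
    have h2 : ∀ i : Fin (m + 1), (((T.filter fun n : ℕ =>
        (n : ℝ) * s / r ≤ t i ∧ t i ≤ n * s / r + 2 * (s / r)).card : ℕ) : ℝ) ≤ 3 := by
      intro i
      refine (card_le_of_forall_mem_Icc (u := t i * r / s - 2) (v := t i * r / s) (by linarith)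
        ?_).trans (by linarith)
      intro n hn
      obtain ⟨-, h3, h4⟩ := mem_filter.1 hn
      refine ⟨?_, (hconv _ n).1 h3⟩
      rw [sub_le_iff_le_add, div_le_iff₀ hs0]
      have h5 : (n : ℝ) * s / r + 2 * (s / r) = (n + 2) * s / r := by ring
      rwa [h5, le_div_iff₀ hr0] at h4
    have h3 : b * r / s - (y * r / s - 2) + 1 ≤ 3 * r * (b - y) + 3 := by
      have h4 : b * r / s - y * r / s ≤ 3 * r * (b - y) := by
        rw [← sub_div, div_le_iff₀ hs0]
        have : 0 ≤ r * (b - y) := mul_nonneg hr0.le (by linarith)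
        nlinarith
      linarith
    have h4 : ((univ.biUnion fun i : Fin (m + 1) => T.filter fun n : ℕ =>
      (n : ℝ) * s / r ≤ t i ∧ t i ≤ n * s / r + 2 * (s / r)).card : ℝ) ≤ (m + 1) * 3 := by
      refine (Nat.cast_le.2 card_biUnion_le).trans ?_
      rw [Nat.cast_sum]
      refine (sum_le_sum fun i _ => h2 i).trans ?_
      rw [sum_const, card_univ, Fintype.card_fin, nsmul_eq_mul]
      push_cast
      exact le_rfl
    have h5 : (E.card : ℝ) ≤ _ := Nat.cast_le.2 (card_union_le _ _)
    rw [Nat.cast_add] at h5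
    linarith
  have hrestsum : |∑ n ∈ T \ U, sawtooth (r * s * h (n * s / r))| ≤
      3 * r * (b - y) + 3 + (m + 1) * 3 := by
    refine (abs_sum_le_sum_abs _ _).trans ?_
    refine (sum_le_sum fun n _ => abs_sawtooth_le _).trans ?_
    rw [sum_const, nsmul_eq_mul]
    have h1 : ((T \ U).card : ℝ) ≤ E.card := by exact_mod_cast card_le_card hrest
    have h2 : (0 : ℝ) ≤ (T \ U).card := by positivity
    linarith
  rw [← sum_sdiff hUT]
  refine (abs_add_le _ _).trans ((add_le_add hrestsum hUsum).trans ?_)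
  set P := r ^ (2 / 3 : ℝ)
  set Q := √r * √(1 / secondDeriv h a b y)
  set R := r * (b - y)
  have hQ : 0 ≤ Q := by positivity
  have hR : 0 ≤ R := mul_nonneg hr0.le (by linarith)
  have h1 : 720 * √r * √(1 / μ) ≤ 720 * √(1 / c) * P + 720 * Q := by
    calc 720 * √r * √(1 / μ) ≤ 720 * √r * (√(1 / c) + √(1 / secondDeriv h a b y)) := by gcongr
      _ = 720 * √(1 / c) * √r + 720 * Q := by ring
      _ ≤ _ := by gcongr
  have h2 : A * P + 720 * √r * √(1 / μ) ≤ (A + 720 * √(1 / c) + 720) * (P + Q + R) := by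
    have : 0 ≤ √(1 / c) := Real.sqrt_nonneg _
    have h4 : 0 ≤ A * (Q + R) := by positivity
    have h5 : 0 ≤ √(1 / c) * (Q + R) := by positivity
    nlinarith
  have h3 : 3 * r * (b - y) + 3 + ((m : ℝ) + 1) * 3 ≤ (3 * m + 10) * (P + Q + R) := by
    have hm0 : (0 : ℝ) ≤ m := by positivity
    have h4 : 0 ≤ (m : ℝ) * (P - 1 + Q + R) := mul_nonneg hm0 (by linarith)
    have h5 : 3 * r * (b - y) = 3 * R := by ring
    nlinarith
  have h4 := mul_le_mul_of_nonneg_left h2 (by positivity : (0 : ℝ) ≤ m)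
  linarith

/-! ### Sums and integrals of convex decreasing functions -/

theorem ConvexOn.le_chord {Φ : ℝ → ℝ} {s : Set ℝ} (hΦ : ConvexOn ℝ s Φ) {p x : ℝ} (hp : p ∈ s)
    (hp1 : p + 1 ∈ s) (h1 : p ≤ x) (h2 : x ≤ p + 1) :
    Φ x ≤ Φ p + (Φ (p + 1) - Φ p) * (x - p) := by
  have := hΦ.2 hp hp1 (by linarith : 0 ≤ p + 1 - x) (by linarith : 0 ≤ x - p) (by ring)
  simp only [smul_eq_mul] at this
  rw [show (p + 1 - x) * p + (x - p) * (p + 1) = x by ring] at this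
  linarith

theorem ConvexOn.extended_chord_le {Φ : ℝ → ℝ} {s : Set ℝ} (hΦ : ConvexOn ℝ s Φ) {q x : ℝ}
    (hx : x ∈ s) (hq1 : q + 1 ∈ s) (h1 : x ≤ q) :
    Φ q + (Φ (q + 1) - Φ q) * (x - q) ≤ Φ x := by
  have h0 : 0 < q + 1 - x := by linarith
  have := hΦ.2 hx hq1 (by positivity : 0 ≤ 1 / (q + 1 - x))
    (div_nonneg (by linarith) h0.le : 0 ≤ (q - x) / (q + 1 - x)) (by rw [← add_div, div_eq_one_iff_eq h0.ne']; ring)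
  simp only [smul_eq_mul] at this
  have h2 : 1 / (q + 1 - x) * x + (q - x) / (q + 1 - x) * (q + 1) = q := by
    field_simp; ring
  rw [h2, div_mul_eq_mul_div, div_mul_eq_mul_div, ← add_div, le_div_iff₀ h0] at this
  linarith

theorem integral_linear (A B c p : ℝ) :
    ∫ x in p..(p + 1), (A + B * (x - c)) = A + B * (p + 1 / 2 - c) := by
  rw [intervalIntegral.integral_add (by simp) (by
    apply Continuous.intervalIntegrable; fun_prop)]
  rw [intervalIntegral.integral_const_mul, intervalIntegral.integral_sub (by simp) (by simp)]
  simp only [intervalIntegral.integral_const, integral_id, smul_eq_mul]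
  ring

section Trapezoid

variable {Φ : ℝ → ℝ} {p : ℝ}

theorem AntitoneOn.intervalIntegrable_of_Ici (hanti : AntitoneOn Φ (Set.Ici p)) {a b : ℝ}
    (ha : p ≤ a) (hb : p ≤ b) : IntervalIntegrable Φ MeasureTheory.volume a b :=
  (hanti.mono fun _ hx => (le_min ha hb).trans hx.1).intervalIntegrable

theorem integral_le_trapezoid (hΦ : ConvexOn ℝ (Set.Ici p) Φ) (hanti : AntitoneOn Φ (Set.Ici p))
    {q : ℝ} (hq : p ≤ q) : ∫ x in q..(q + 1), Φ x ≤ (Φ q + Φ (q + 1)) / 2 := by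
  refine (intervalIntegral.integral_mono_on (g := fun x => Φ q + (Φ (q + 1) - Φ q) * (x - q))
    (by linarith) (hanti.intervalIntegrable_of_Ici hq (by linarith))
    (by apply Continuous.intervalIntegrable; fun_prop) fun x hx =>
      hΦ.le_chord hq (by simp only [Set.mem_Ici]; linarith) hx.1 hx.2).trans ?_
  rw [integral_linear]
  linarith

/-- The chord over `[q + 1, q + 2]`, extended to the left, lies below the graph on `[q, q + 1]`.
Summed over cells, the error is a telescoping change of slope, so no derivative enters. -/
theorem le_integral_of_convexOn (hΦ : ConvexOn ℝ (Set.Ici p) Φ)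
    (hanti : AntitoneOn Φ (Set.Ici p)) {q : ℝ} (hq : p ≤ q) :
    Φ (q + 1) - (Φ (q + 1 + 1) - Φ (q + 1)) / 2 ≤ ∫ x in q..(q + 1), Φ x := by
  have := intervalIntegral.integral_mono_on
    (f := fun x => Φ (q + 1) + (Φ (q + 1 + 1) - Φ (q + 1)) * (x - (q + 1)))
    (g := Φ) (a := q) (b := q + 1)
    (by linarith) (by apply Continuous.intervalIntegrable; fun_prop)
    (hanti.intervalIntegrable_of_Ici hq (by linarith)) fun x hx =>
      hΦ.extended_chord_le (hq.trans hx.1) (by simp only [Set.mem_Ici]; linarith) hx.2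
  rw [integral_linear] at this
  linarith

theorem integral_le_sum_trapezoid (hΦ : ConvexOn ℝ (Set.Ici p) Φ)
    (hanti : AntitoneOn Φ (Set.Ici p)) (k : ℕ) :
    ∫ x in p..(p + k), Φ x ≤ ∑ i ∈ range k, Φ (p + i) - (Φ p - Φ (p + k)) / 2 := by
  induction k with
  | zero => simp
  | succ k ih =>
    have hk : p ≤ p + k := by simp
    have h1 := integral_le_trapezoid hΦ hanti hk
    rw [sum_range_succ, Nat.cast_succ, ← add_assoc,
      ← intervalIntegral.integral_add_adjacent_intervals
        (hanti.intervalIntegrable_of_Ici le_rfl hk)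
        (hanti.intervalIntegrable_of_Ici hk (by linarith))]
    linarith

theorem sum_le_integral_add (hΦ : ConvexOn ℝ (Set.Ici p) Φ)
    (hanti : AntitoneOn Φ (Set.Ici p)) (k : ℕ) :
    ∑ i ∈ range k, Φ (p + i) ≤ (∫ x in p..(p + k), Φ x) + (Φ p - Φ (p + k)) / 2 +
      ((Φ (p + k + 1) - Φ (p + k)) - (Φ (p + 1) - Φ p)) / 2 := by
  induction k with
  | zero => simp
  | succ k ih =>
    have hk : p ≤ p + k := by simp
    have h1 := le_integral_of_convexOn hΦ hanti hk
    rw [sum_range_succ, Nat.cast_succ, ← add_assoc,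
      ← intervalIntegral.integral_add_adjacent_intervals
        (hanti.intervalIntegrable_of_Ici le_rfl hk)
        (hanti.intervalIntegrable_of_Ici hk (by linarith))]
    linarith

end Trapezoid

theorem sum_Ioc_eq_sum_range (Φ : ℝ → ℝ) (m n : ℕ) :
    ∑ j ∈ Ioc m n, Φ j = ∑ i ∈ range (n - m), Φ ((m + 1 : ℕ) + i) := by
  have : Ioc m n = Ico (m + 1) (n + 1) := by
    ext j; simp only [mem_Ioc, mem_Ico]; omega
  rw [this, sum_Ico_eq_sum_range]
  rw [show n + 1 - (m + 1) = n - m by omega]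
  simp

/-- The sum of a convex decreasing function that vanishes beyond `R`. -/
theorem abs_sum_sub_integral_le {Φ : ℝ → ℝ} {a R K : ℝ} (ha : 0 ≤ a) (haR : a ≤ R)
    (hΦ : ConvexOn ℝ (Set.Ici a) Φ) (hanti : AntitoneOn Φ (Set.Ici a))
    (hR : ∀ x, R ≤ x → Φ x = 0) (hK0 : 0 ≤ K)
    (hK : ∀ x y, a ≤ x → x ≤ y → Φ x - Φ y ≤ K * (y - x)) :
    |∑ j ∈ Ioc ⌊a⌋₊ ⌊R⌋₊, Φ j - ((∫ x in a..R, Φ x) + sawtooth a * Φ a)| ≤ 2 * K := by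
  rw [sum_Ioc_eq_sum_range]
  set p : ℝ := ((⌊a⌋₊ + 1 : ℕ) : ℝ) with hp
  set k := ⌊R⌋₊ - ⌊a⌋₊ with hk
  have hfl : ⌊a⌋₊ ≤ ⌊R⌋₊ := Nat.floor_le_floor haR
  have hap : a ≤ p := by
    rw [hp]; push_cast; exact (Nat.lt_floor_add_one a).le
  have hpk : p + k = ⌊R⌋₊ + 1 := by
    rw [hp, hk, Nat.cast_sub hfl]; push_cast; ring
  have hpa : p - a = 1 - Int.fract a := by
    rw [hp, ← Int.self_sub_floor, ← natCast_floor_eq_intCast_floor ha]; push_cast; ring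
  have hRpk : R ≤ p + k := by rw [hpk]; exact (Nat.lt_floor_add_one R).le
  have hsub : Set.Ici p ⊆ Set.Ici a := Set.Ici_subset_Ici.2 hap
  have h1 := integral_le_sum_trapezoid (hΦ.subset hsub (convex_Ici p)) (hanti.mono hsub) k
  have h2 := sum_le_integral_add (hΦ.subset hsub (convex_Ici p)) (hanti.mono hsub) k
  rw [hR (p + k) hRpk, hR (p + k + 1) (by linarith)] at h2
  rw [hR (p + k) hRpk] at h1
  have hI : ∀ {x y : ℝ}, a ≤ x → a ≤ y → IntervalIntegrable Φ MeasureTheory.volume x y :=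
    @fun x y hx hy => hanti.intervalIntegrable_of_Ici hx hy
  have h3 : ∫ x in R..(p + k), Φ x = 0 := by
    rw [intervalIntegral.integral_congr (g := fun _ => 0)]
    · simp
    · intro x hx
      rw [Set.uIcc_of_le hRpk] at hx
      exact hR x hx.1
  have h4 : (∫ x in a..R, Φ x) = (∫ x in a..p, Φ x) + ∫ x in p..(p + k), Φ x := by
    rw [intervalIntegral.integral_add_adjacent_intervals (hI le_rfl hap) (hI hap (by linarith)),
      ← intervalIntegral.integral_add_adjacent_intervals (hI le_rfl haR) (hI (y := p + k) haR (by linarith)),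
      h3, add_zero]
  have hf0 := Int.fract_nonneg a
  have hf1 := Int.fract_lt_one a
  -- The incomplete first cell `[a, p]` has length `1 - fract a`. Its integral, about `(1 - fract a)
  -- * Φ a`, and the half weight of the trapezoid rule at `p` combine to `sawtooth a * Φ a`.
  have h5 : (∫ x in a..p, Φ x) ≤ (p - a) * Φ a := by
    have := intervalIntegral.integral_mono_on hap (hI le_rfl hap)
      (intervalIntegrable_const (c := Φ a)) fun x hx => hanti (Set.mem_Ici.2 le_rfl) hx.1 hx.1
    rwa [intervalIntegral.integral_const, smul_eq_mul] at this
  have h6 : (p - a) * Φ p ≤ ∫ x in a..p, Φ x := by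
    have := intervalIntegral.integral_mono_on hap (intervalIntegrable_const (c := Φ p))
      (hI le_rfl hap) fun x hx => hanti hx.1 hap hx.2
    rwa [intervalIntegral.integral_const, smul_eq_mul] at this
  have h7 := hK a p le_rfl hap
  have h8 := hK p (p + 1) hap (by linarith)
  have h9 : Φ p ≤ Φ a := hanti (Set.mem_Ici.2 le_rfl) hap hap
  have h10 : Φ (p + 1) ≤ Φ p := hanti hap (by simp only [Set.mem_Ici]; linarith) (by linarith)
  rw [hpa] at h5 h6 h7
  have h11 : Φ a - Φ p ≤ K := by nlinarith
  have h12 : (1 - Int.fract a) * (Φ a - Φ p) ≤ K := by nlinarith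
  rw [h4, sawtooth, abs_le]
  constructor <;> linarith

/-- Slopes to the right of `a` are at least the slope of the chord over `[0, a]`. Hence a Lipschitz
bound away from `0`, even if the curve is vertical there. -/
theorem ConvexOn.sub_le_of_antitoneOn {h : ℝ → ℝ} {ℓ a : ℝ} (hc : ConvexOn ℝ (Set.Icc 0 ℓ) h)
    (ha : 0 < a) {x y : ℝ} (hax : a ≤ x) (hxy : x ≤ y) (hy : y ≤ ℓ) :
    h x - h y ≤ (h 0 - h a) / a * (y - x) := by
  have m0 : (0 : ℝ) ∈ Set.Icc 0 ℓ := ⟨le_rfl, by linarith⟩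
  have mx : x ∈ Set.Icc 0 ℓ := ⟨by linarith, by linarith⟩
  have my : y ∈ Set.Icc 0 ℓ := ⟨by linarith, hy⟩
  rcases eq_or_lt_of_le hxy with rfl | hxy
  · simp
  have key : (h a - h 0) / a ≤ (h y - h x) / (y - x) := by
    rcases eq_or_lt_of_le hax with rfl | hax
    · have := hc.slope_mono_adjacent m0 my ha hxy
      rwa [sub_zero] at this
    · have h1 := hc.slope_mono_adjacent m0 mx ha hax
      rw [sub_zero] at h1
      exact h1.trans (hc.slope_mono_adjacent ⟨ha.le, by linarith⟩ my hax hxy)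
  rw [le_div_iff₀ (by linarith)] at key
  have : (h a - h 0) / a = -((h 0 - h a) / a) := by ring
  rw [this] at key
  linarith

/-! ### Lattice points in columns under a scaled curve -/

/-- The points `(j, k)` with `j ∈ T` and `0 ≤ k ≤ F j`. -/
theorem ncard_natural_points_le (T : Finset ℕ) (F : ℕ → ℝ) (hF : ∀ j ∈ T, 0 ≤ F j) :
    {p : ℕ × ℕ | p.1 ∈ T ∧ (p.2 : ℝ) ≤ F p.1}.ncard = ∑ j ∈ T, (⌊F j⌋₊ + 1) := by
  have : {p : ℕ × ℕ | p.1 ∈ T ∧ (p.2 : ℝ) ≤ F p.1} =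
      (((T.sigma fun j => range (⌊F j⌋₊ + 1)).map (Equiv.sigmaEquivProd ℕ ℕ).toEmbedding :
        Finset (ℕ × ℕ)) : Set (ℕ × ℕ)) := by
    ext ⟨j, k⟩
    simp only [Set.mem_ofPred_eq, coe_map, Set.mem_image, mem_coe, mem_sigma, mem_range,
      Equiv.coe_toEmbedding, Equiv.sigmaEquivProd_apply, Sigma.exists, Prod.mk.injEq]
    constructor
    · rintro ⟨h1, h2⟩
      exact ⟨j, k, ⟨h1, Nat.lt_succ_of_le (Nat.le_floor h2)⟩, rfl, rfl⟩
    · rintro ⟨j', k', ⟨h1, h2⟩, rfl, rfl⟩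
      exact ⟨h1, (Nat.le_floor_iff (hF _ h1)).1 (Nat.lt_succ_iff.1 h2)⟩
  rw [this, Set.ncard_coe_finset, card_map, card_sigma]
  simp

/-- A convex decreasing function on `[0, ℓ]` that vanishes at `ℓ`. -/
structure ConvexDecreasing (h : ℝ → ℝ) (ℓ : ℝ) : Prop where
  pos : 0 < ℓ
  convexOn : ConvexOn ℝ (Set.Icc 0 ℓ) h
  antitoneOn : AntitoneOn h (Set.Icc 0 ℓ)
  right : h ℓ = 0

/-- The function `x ↦ r s h (s x / r)`, extended by zero. -/
noncomputable def scaledExtension (h : ℝ → ℝ) (ℓ r s x : ℝ) : ℝ := r * s * h (min (x * (s / r)) ℓ)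

namespace ConvexDecreasing

variable {h : ℝ → ℝ} {ℓ r s : ℝ}

theorem nonneg (H : ConvexDecreasing h ℓ) {x : ℝ} (hx : x ∈ Set.Icc 0 ℓ) : 0 ≤ h x := by
  rw [← H.right]; exact H.antitoneOn hx ⟨H.pos.le, le_rfl⟩ hx.2

theorem min_mem (H : ConvexDecreasing h ℓ) (hr : 0 < r) (hs : 0 < s) {x : ℝ} (hx : 0 ≤ x) :
    min (x * (s / r)) ℓ ∈ Set.Icc 0 ℓ :=
  ⟨le_min (by positivity) H.pos.le, min_le_right _ _⟩

theorem antitoneOn_scaledExtension (H : ConvexDecreasing h ℓ) (hr : 0 < r) (hs : 0 < s) :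
    AntitoneOn (scaledExtension h ℓ r s) (Set.Ici 0) := by
  intro x hx y hy hxy
  refine mul_le_mul_of_nonneg_left (H.antitoneOn (H.min_mem hr hs hx) (H.min_mem hr hs hy) ?_)
    (by positivity)
  exact min_le_min_right _ (mul_le_mul_of_nonneg_right hxy (by positivity))

/-- A convex decreasing function of the concave function `x ↦ min (x * (s / r)) ℓ` is convex.
Extending by zero removes the boundary effects at the right end. -/
theorem convexOn_scaledExtension (H : ConvexDecreasing h ℓ) (hr : 0 < r) (hs : 0 < s) :
    ConvexOn ℝ (Set.Ici 0) (scaledExtension h ℓ r s) := by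
  refine ⟨convex_Ici 0, fun x hx y hy t u ht hu htu => ?_⟩
  have mx := H.min_mem hr hs hx
  have my := H.min_mem hr hs hy
  simp only [smul_eq_mul, scaledExtension]
  have h1 := H.convexOn.2 mx my ht hu htu
  have hxy : (0 : ℝ) ≤ t * x + u * y :=
    add_nonneg (mul_nonneg ht hx) (mul_nonneg hu hy)
  have h2 : h (min ((t * x + u * y) * (s / r)) ℓ) ≤
      h (t • min (x * (s / r)) ℓ + u • min (y * (s / r)) ℓ) := by
    refine H.antitoneOn (H.convexOn.1 mx my ht hu htu) (H.min_mem hr hs hxy) ?_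
    simp only [smul_eq_mul]
    refine le_min ?_ ?_
    · have h3 := mul_le_mul_of_nonneg_left (min_le_left (x * (s / r)) ℓ) ht
      have h4 := mul_le_mul_of_nonneg_left (min_le_left (y * (s / r)) ℓ) hu
      linarith
    · have h3 := mul_le_mul_of_nonneg_left (min_le_right (x * (s / r)) ℓ) ht
      have h4 := mul_le_mul_of_nonneg_left (min_le_right (y * (s / r)) ℓ) hu
      have h5 : t * ℓ + u * ℓ = ℓ := by rw [← add_mul, htu, one_mul]
      linarith
  have h3 := mul_le_mul_of_nonneg_left (h2.trans h1) (by positivity : 0 ≤ r * s)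
  simp only [smul_eq_mul] at h3
  linarith

theorem scaledExtension_eq_zero (H : ConvexDecreasing h ℓ) (hr : 0 < r) (hs : 0 < s) {x : ℝ}
    (hx : r * ℓ / s ≤ x) : scaledExtension h ℓ r s x = 0 := by
  rw [scaledExtension, min_eq_right, H.right, mul_zero]
  rw [div_le_iff₀ hs] at hx
  rw [← mul_div_assoc, le_div_iff₀ hr]
  linarith

theorem scaledExtension_of_le (_ : ConvexDecreasing h ℓ) (hr : 0 < r) (hs : 0 < s) {x : ℝ}
    (hx : x ≤ r * ℓ / s) : scaledExtension h ℓ r s x = r * s * h (x * s / r) := by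
  rw [scaledExtension, min_eq_left, mul_div_assoc]
  rw [le_div_iff₀ hs] at hx
  rw [← mul_div_assoc, div_le_iff₀ hr]
  linarith

theorem integral_scaledExtension (_ : ConvexDecreasing h ℓ) (hr : 0 < r) (hs : 0 < s) {a : ℝ}
    (haℓ : a ≤ ℓ) :
    ∫ x in (r * a / s)..(r * ℓ / s), scaledExtension h ℓ r s x = r ^ 2 * ∫ x in a..ℓ, h x := by
  have hu : s / r ≠ 0 := by positivity
  simp only [scaledExtension]
  rw [intervalIntegral.integral_const_mul,
    intervalIntegral.integral_comp_mul_right (fun x => h (min x ℓ)) hu]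
  have e1 : ∀ z : ℝ, r * z / s * (s / r) = z := fun z => by field_simp
  rw [e1, e1, smul_eq_mul, ← mul_assoc]
  congr 1
  · field_simp
  · refine intervalIntegral.integral_congr fun x hx => ?_
    rw [Set.uIcc_of_le haℓ] at hx
    simp only [min_eq_left hx.2]

/-- Lower bound for the number of lattice points, from the trapezoid rule. -/
theorem le_sum_floor (H : ConvexDecreasing h ℓ) (hr : 0 < r) (hs : 0 < s) :
    (r ^ 2 * ∫ x in (0 : ℝ)..ℓ, h x) + r * s * h 0 / 2 ≤
      ((∑ j ∈ range (⌊r * ℓ / s⌋₊ + 1), (⌊r * s * h (j * s / r)⌋₊ + 1) : ℕ) : ℝ) := by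
  set R := r * ℓ / s with hR
  have hR0 : 0 < R := by have := H.pos; positivity
  set k := ⌊R⌋₊ + 1 with hk
  have hRk : R ≤ 0 + k := by
    rw [hk, zero_add]; push_cast; exact (Nat.lt_floor_add_one R).le
  have hanti := H.antitoneOn_scaledExtension hr hs
  have h1 := integral_le_sum_trapezoid (H.convexOn_scaledExtension hr hs) hanti k
  rw [← intervalIntegral.integral_add_adjacent_intervals (b := R)
    (hanti.intervalIntegrable_of_Ici le_rfl hR0.le)
    (hanti.intervalIntegrable_of_Ici hR0.le (by linarith))] at h1
  have h2 : ∫ x in R..(0 + k), scaledExtension h ℓ r s x = 0 := by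
    rw [intervalIntegral.integral_congr (g := fun _ => 0)]
    · simp
    · intro x hx
      rw [Set.uIcc_of_le hRk] at hx
      exact H.scaledExtension_eq_zero hr hs hx.1
  have h3 := H.integral_scaledExtension hr hs H.pos.le
  rw [mul_zero, zero_div, ← hR] at h3
  rw [h2, h3, H.scaledExtension_eq_zero hr hs hRk, H.scaledExtension_of_le hr hs (by positivity),
    zero_mul, zero_div] at h1
  have h4 : ∑ i ∈ range k, scaledExtension h ℓ r s (0 + i) ≤
      ((∑ j ∈ range k, (⌊r * s * h (j * s / r)⌋₊ + 1) : ℕ) : ℝ) := by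
    rw [Nat.cast_sum]
    refine sum_le_sum fun j hj => ?_
    have hjR : (j : ℝ) ≤ R :=
      (Nat.le_floor_iff hR0.le).1 (Nat.lt_succ_iff.1 (mem_range.1 hj))
    rw [zero_add, H.scaledExtension_of_le hr hs hjR]
    push_cast
    exact (Nat.lt_floor_add_one _).le
  linarith

/-- The number of lattice points in the columns to the right of `a`, up to a sawtooth sum. -/
theorem abs_sum_floor_sub_le (H : ConvexDecreasing h ℓ) (hr : 0 < r) (hs : 0 < s) {a K : ℝ}
    (ha : 0 < a) (haℓ : a ≤ ℓ) (hK0 : 0 ≤ K)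
    (hK : ∀ x y, a ≤ x → x ≤ y → y ≤ ℓ → h x - h y ≤ K * (y - x)) :
    |((∑ j ∈ Ioc ⌊r * a / s⌋₊ ⌊r * ℓ / s⌋₊, (⌊r * s * h (j * s / r)⌋₊ + 1) : ℕ) : ℝ) -
      ((r ^ 2 * ∫ x in a..ℓ, h x) + sawtooth (r * a / s) * (r * s * h a) +
        (r * ℓ / s - r * a / s) / 2)| ≤
    |∑ j ∈ Ioc ⌊r * a / s⌋₊ ⌊r * ℓ / s⌋₊, sawtooth (r * s * h (j * s / r))| +
      (1 + 2 * (s ^ 2 * K)) := by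
  set A := r * a / s with hA
  set R := r * ℓ / s with hR
  have hA0 : 0 < A := by positivity
  have hAR : A ≤ R := by rw [hA, hR]; gcongr
  have hR0 : 0 < R := by linarith
  have hsub : Set.Ici A ⊆ Set.Ici (0 : ℝ) := Set.Ici_subset_Ici.2 hA0.le
  have e1 : ∀ z : ℝ, r * z / s * (s / r) = z := fun z => by field_simp
  have hAa : ∀ x, A ≤ x → a ≤ x * (s / r) := fun x hx => by
    rw [← e1 a]; exact mul_le_mul_of_nonneg_right hx (by positivity)
  have hKΦ : ∀ x y, A ≤ x → x ≤ y →
      scaledExtension h ℓ r s x - scaledExtension h ℓ r s y ≤ s ^ 2 * K * (y - x) := by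
    intro x y hx hxy
    have hu : 0 < s / r := by positivity
    have hxy' : x * (s / r) ≤ y * (s / r) := mul_le_mul_of_nonneg_right hxy hu.le
    have h1 := hK (min (x * (s / r)) ℓ) (min (y * (s / r)) ℓ) (le_min (hAa x hx) haℓ)
      (min_le_min_right _ hxy') (min_le_right _ _)
    have h2 : min (y * (s / r)) ℓ - min (x * (s / r)) ℓ ≤ y * (s / r) - x * (s / r) := by
      rcases le_total (x * (s / r)) ℓ with h3 | h3
      · rw [min_eq_left h3]; linarith [min_le_left (y * (s / r)) ℓ]
      · rw [min_eq_right h3]; linarith [min_le_right (y * (s / r)) ℓ]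
    have h3 := h1.trans (mul_le_mul_of_nonneg_left h2 hK0)
    calc scaledExtension h ℓ r s x - scaledExtension h ℓ r s y
        = r * s * (h (min (x * (s / r)) ℓ) - h (min (y * (s / r)) ℓ)) := by
          simp only [scaledExtension]; ring
      _ ≤ r * s * (K * (y * (s / r) - x * (s / r))) :=
          mul_le_mul_of_nonneg_left h3 (by positivity)
      _ = _ := by field_simp
  have h1 := abs_sum_sub_integral_le hA0.le hAR
    ((H.convexOn_scaledExtension hr hs).subset hsub (convex_Ici A))
    ((H.antitoneOn_scaledExtension hr hs).mono hsub)
    (fun x hx => H.scaledExtension_eq_zero hr hs hx) (by positivity) hKΦ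
  rw [H.integral_scaledExtension hr hs haℓ, H.scaledExtension_of_le hr hs hAR,
    show A * s / r = a by rw [mul_div_assoc, e1]] at h1
  -- From `⌊y⌋ + 1 = y - sawtooth y + 1/2`; the halves add up to half the number of columns.
  have h2 : ((∑ j ∈ Ioc ⌊A⌋₊ ⌊R⌋₊, (⌊r * s * h (j * s / r)⌋₊ + 1) : ℕ) : ℝ) =
      ∑ j ∈ Ioc ⌊A⌋₊ ⌊R⌋₊, scaledExtension h ℓ r s j -
        ∑ j ∈ Ioc ⌊A⌋₊ ⌊R⌋₊, sawtooth (r * s * h (j * s / r)) + ((⌊R⌋₊ : ℝ) - ⌊A⌋₊) / 2 := by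
    have h3 : ((⌊R⌋₊ : ℝ) - ⌊A⌋₊) / 2 = ∑ j ∈ Ioc ⌊A⌋₊ ⌊R⌋₊, (1 / 2 : ℝ) := by
      rw [sum_const, Nat.card_Ioc, nsmul_eq_mul, Nat.cast_sub (Nat.floor_le_floor hAR)]; ring
    rw [h3, Nat.cast_sum, ← sum_sub_distrib, ← sum_add_distrib]
    refine sum_congr rfl fun j hj => ?_
    have hjR : (j : ℝ) ≤ R := (Nat.le_floor_iff hR0.le).1 (mem_Ioc.1 hj).2
    rw [H.scaledExtension_of_le hr hs hjR]
    have hmem : (j : ℝ) * s / r ∈ Set.Icc 0 ℓ := by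
      refine ⟨by positivity, ?_⟩
      rw [hR, le_div_iff₀ hs] at hjR
      rw [div_le_iff₀ hr]; linarith
    have hpos : 0 ≤ r * s * h (j * s / r) := mul_nonneg (by positivity) (H.nonneg hmem)
    rw [sawtooth, ← Int.self_sub_floor, ← natCast_floor_eq_intCast_floor hpos]
    push_cast
    ring
  have h3 := Nat.floor_le hA0.le
  have h4 := Nat.lt_floor_add_one A
  have h5 := Nat.floor_le hR0.le
  have h6 := Nat.lt_floor_add_one R
  rw [h2]
  have h7 := abs_le.1 h1
  set W := ∑ j ∈ Ioc ⌊A⌋₊ ⌊R⌋₊, sawtooth (r * s * h (j * s / r))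
  have h8 := le_abs_self W
  have h9 := neg_abs_le W
  rw [abs_le]
  constructor <;> linarith

end ConvexDecreasing

/-! ### The inverse curve and reflection in the diagonal -/

namespace IsConvexDecreasingCurve

variable {f : ℝ → ℝ} {L M : ℝ}

theorem height_pos (hΓ : IsConvexDecreasingCurve f L M) : 0 < M := by
  have := hΓ.strictAntiOn ⟨le_rfl, hΓ.pos.le⟩ ⟨hΓ.pos.le, le_rfl⟩ hΓ.pos
  rwa [hΓ.left, hΓ.right] at this

theorem convexDecreasing (hΓ : IsConvexDecreasingCurve f L M) : ConvexDecreasing f L :=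
  ⟨hΓ.pos, hΓ.convexOn, hΓ.strictAntiOn.antitoneOn, hΓ.right⟩

theorem map_mem (hΓ : IsConvexDecreasingCurve f L M) {x : ℝ} (hx : x ∈ Set.Icc 0 L) :
    f x ∈ Set.Icc 0 M := by
  refine ⟨hΓ.convexDecreasing.nonneg hx, ?_⟩
  rw [← hΓ.left]
  exact hΓ.strictAntiOn.antitoneOn ⟨le_rfl, hΓ.pos.le⟩ hx hx.1

theorem mem_image (hΓ : IsConvexDecreasingCurve f L M) {y : ℝ} (hy : y ∈ Set.Icc 0 M) :
    y ∈ f '' Set.Icc 0 L := by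
  apply intermediate_value_Icc' hΓ.pos.le hΓ.continuousOn
  rwa [hΓ.left, hΓ.right]

theorem curveInverse_mem (hΓ : IsConvexDecreasingCurve f L M) {y : ℝ} (hy : y ∈ Set.Icc 0 M) :
    curveInverse f L y ∈ Set.Icc 0 L :=
  Function.invFunOn_mem (hΓ.mem_image hy)

theorem apply_curveInverse (hΓ : IsConvexDecreasingCurve f L M) {y : ℝ} (hy : y ∈ Set.Icc 0 M) :
    f (curveInverse f L y) = y :=
  Function.invFunOn_eq (hΓ.mem_image hy)

theorem le_apply_iff (hΓ : IsConvexDecreasingCurve f L M) {x y : ℝ} (hx : x ∈ Set.Icc 0 L)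
    (hy : y ∈ Set.Icc 0 M) : y ≤ f x ↔ x ≤ curveInverse f L y := by
  have := hΓ.strictAntiOn.le_iff_ge (hΓ.curveInverse_mem hy) hx
  rwa [hΓ.apply_curveInverse hy] at this

theorem lt_apply_iff (hΓ : IsConvexDecreasingCurve f L M) {x y : ℝ} (hx : x ∈ Set.Icc 0 L)
    (hy : y ∈ Set.Icc 0 M) : y < f x ↔ x < curveInverse f L y := by
  have := hΓ.strictAntiOn.lt_iff_gt (hΓ.curveInverse_mem hy) hx
  rwa [hΓ.apply_curveInverse hy] at this

theorem curveInverse_apply (hΓ : IsConvexDecreasingCurve f L M) {x : ℝ} (hx : x ∈ Set.Icc 0 L) :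
    curveInverse f L (f x) = x :=
  hΓ.strictAntiOn.injOn (hΓ.curveInverse_mem (hΓ.map_mem hx)) hx
    (hΓ.apply_curveInverse (hΓ.map_mem hx))

theorem convexDecreasing_curveInverse (hΓ : IsConvexDecreasingCurve f L M) :
    ConvexDecreasing (curveInverse f L) M where
  pos := hΓ.height_pos
  convexOn := by
    refine ⟨convex_Icc 0 M, fun x hx y hy t u ht hu htu => ?_⟩
    have h1 := hΓ.curveInverse_mem hx
    have h2 := hΓ.curveInverse_mem hy
    have h3 := hΓ.convexOn.2 h1 h2 ht hu htu
    rw [hΓ.apply_curveInverse hx, hΓ.apply_curveInverse hy] at h3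
    by_contra! h4
    have h5 := (hΓ.lt_apply_iff (hΓ.convexOn.1 h1 h2 ht hu htu)
      ((convex_Icc 0 M) hx hy ht hu htu)).2 h4
    linarith
  antitoneOn := by
    intro x hx y hy hxy
    rw [← hΓ.le_apply_iff (hΓ.curveInverse_mem hy) hx, hΓ.apply_curveInverse hy]
    exact hxy
  right := by
    rw [← hΓ.left]
    exact hΓ.curveInverse_apply ⟨le_rfl, hΓ.pos.le⟩

theorem curveInverse_zero (hΓ : IsConvexDecreasingCurve f L M) : curveInverse f L 0 = L := by
  rw [← hΓ.right]
  exact hΓ.curveInverse_apply ⟨hΓ.pos.le, le_rfl⟩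

end IsConvexDecreasingCurve

/-- The region under a decreasing function, and under its inverse, have the same area. -/
theorem integral_sub_eq_of_inverse {φ γ : ℝ → ℝ} {a b c d : ℝ} (hab : a ≤ b) (hcd : c ≤ d)
    (hφ : AntitoneOn φ (Set.Icc a b)) (hγ : AntitoneOn γ (Set.Icc c d))
    (hφm : ∀ x ∈ Set.Ioo a b, φ x ∈ Set.Icc c d) (hγm : ∀ y ∈ Set.Ioo c d, γ y ∈ Set.Icc a b)
    (hinv : ∀ x ∈ Set.Ioo a b, ∀ y ∈ Set.Ioo c d, (y < φ x ↔ x < γ y)) :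
    ∫ x in a..b, (φ x - c) = ∫ y in c..d, (γ y - a) := by
  have key : ∀ {φ : ℝ → ℝ} {a b c : ℝ}, a ≤ b → AntitoneOn φ (Set.Icc a b) →
      (∀ x ∈ Set.Ioo a b, c ≤ φ x) → MeasureTheory.volume
        (regionBetween (fun _ => c) φ (Set.Ioo a b)) = ENNReal.ofReal (∫ x in a..b, (φ x - c)) := by
    intro φ a b c hab hφ hm
    rw [intervalIntegral.integral_of_le hab, MeasureTheory.integral_Ioc_eq_integral_Ioo]
    have hi : IntervalIntegrable φ MeasureTheory.volume a b :=
      (hφ.mono (by rw [Set.uIcc_of_le hab])).intervalIntegrable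
    rw [intervalIntegrable_iff_integrableOn_Ioo_of_le hab] at hi
    exact volume_regionBetween_eq_integral (by simp) hi measurableSet_Ioo hm
  have h1 := key hab hφ fun x hx => (hφm x hx).1
  have h2 := key hcd hγ fun y hy => (hγm y hy).1
  -- Exchanging coordinates carries one region onto the other and preserves area.
  have h3 : Prod.swap ⁻¹' (regionBetween (fun _ => a) γ (Set.Ioo c d)) =
      regionBetween (fun _ => c) φ (Set.Ioo a b) := by
    ext ⟨x, y⟩
    simp only [regionBetween, Set.mem_preimage, Prod.swap_prod_mk, Set.mem_ofPred_eq]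
    constructor
    · rintro ⟨hy, hx⟩
      have hx' : x ∈ Set.Ioo a b := ⟨hx.1, hx.2.trans_le (hγm y hy).2⟩
      exact ⟨hx', hy.1, (hinv x hx' y hy).2 hx.2⟩
    · rintro ⟨hx, hy⟩
      have hy' : y ∈ Set.Ioo c d := ⟨hy.1, hy.2.trans_le (hφm x hx).2⟩
      exact ⟨hy', hx.1, (hinv x hx y hy').1 hy.2⟩
  have h4 : MeasureTheory.volume (Prod.swap ⁻¹' (regionBetween (fun _ => a) γ (Set.Ioo c d))) =
      MeasureTheory.volume (regionBetween (fun _ => a) γ (Set.Ioo c d)) :=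
    (MeasureTheory.Measure.measurePreserving_swap
      (μ := (MeasureTheory.volume : MeasureTheory.Measure ℝ))
      (ν := (MeasureTheory.volume : MeasureTheory.Measure ℝ))).measure_preimage_equiv
      (f := MeasurableEquiv.prodComm) _
  rw [h3, h1, h2] at h4
  have h5 : ∀ {φ : ℝ → ℝ} {a b c : ℝ}, a ≤ b → (∀ x ∈ Set.Ioo a b, c ≤ φ x) →
      0 ≤ ∫ x in a..b, (φ x - c) := by
    intro φ a b c hab hm
    rw [intervalIntegral.integral_of_le hab, MeasureTheory.integral_Ioc_eq_integral_Ioo]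
    exact MeasureTheory.setIntegral_nonneg measurableSet_Ioo fun x hx => by linarith [hm x hx]
  exact (ENNReal.ofReal_eq_ofReal_iff (h5 hab fun x hx => (hφm x hx).1)
    (h5 hcd fun y hy => (hγm y hy).1)).1 h4

namespace IsConvexDecreasingCurve

variable {f : ℝ → ℝ} {L M : ℝ}

theorem integral_curveInverse_eq (hΓ : IsConvexDecreasingCurve f L M) {α : ℝ}
    (hα : α ∈ Set.Icc 0 L) :
    ∫ y in (f α)..M, curveInverse f L y = (∫ x in (0 : ℝ)..α, f x) - α * f α := by
  have hβ := hΓ.map_mem hα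
  have H := hΓ.convexDecreasing
  have G := hΓ.convexDecreasing_curveInverse
  have hsub : Set.Icc 0 α ⊆ Set.Icc 0 L := Set.Icc_subset_Icc_right hα.2
  have hsub' : Set.Icc (f α) M ⊆ Set.Icc 0 M := Set.Icc_subset_Icc_left hβ.1
  have h1 := integral_sub_eq_of_inverse (φ := f) (γ := curveInverse f L) hα.1 hβ.2
    (H.antitoneOn.mono hsub) (G.antitoneOn.mono hsub')
    (fun x hx => by
      have hx' := hsub (Set.Ioo_subset_Icc_self hx)
      exact ⟨H.antitoneOn hx' hα hx.2.le, (hΓ.map_mem hx').2⟩)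
    (fun y hy => by
      have hy' := hsub' (Set.Ioo_subset_Icc_self hy)
      refine ⟨(hΓ.curveInverse_mem hy').1, ?_⟩
      have := G.antitoneOn hβ hy' hy.1.le
      rwa [hΓ.curveInverse_apply hα] at this)
    (fun x hx y hy => hΓ.lt_apply_iff (hsub (Set.Ioo_subset_Icc_self hx))
      (hsub' (Set.Ioo_subset_Icc_self hy)))
  simp only [sub_zero] at h1
  rw [← h1, intervalIntegral.integral_sub
    ((H.antitoneOn.mono (by rwa [Set.uIcc_of_le hα.1])).intervalIntegrable) (by simp)]
  simp

theorem curveArea_eq (hΓ : IsConvexDecreasingCurve f L M) {α : ℝ} (hα : α ∈ Set.Icc 0 L) :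
    curveArea f L = α * f α + (∫ x in α..L, f x) + ∫ y in (f α)..M, curveInverse f L y := by
  have H := hΓ.convexDecreasing
  rw [hΓ.integral_curveInverse_eq hα, curveArea,
    ← intervalIntegral.integral_add_adjacent_intervals (b := α)
    ((H.antitoneOn.mono (by
      rw [Set.uIcc_of_le hα.1]; exact Set.Icc_subset_Icc_right hα.2)).intervalIntegrable)
    ((H.antitoneOn.mono (by
      rw [Set.uIcc_of_le hα.2]; exact Set.Icc_subset_Icc_left hα.1)).intervalIntegrable)]
  ring

theorem integral_curveInverse (hΓ : IsConvexDecreasingCurve f L M) :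
    ∫ y in (0 : ℝ)..M, curveInverse f L y = curveArea f L := by
  have := hΓ.integral_curveInverse_eq ⟨hΓ.pos.le, le_rfl⟩
  rw [hΓ.right, mul_zero, sub_zero] at this
  exact this

theorem swap_mem_closedLatticePoints (hΓ : IsConvexDecreasingCurve f L M) {r s : ℝ} (hr : 0 < r)
    (hs : 0 < s) (p : ℕ × ℕ) :
    p.swap ∈ closedLatticePoints (curveInverse f L) M r s⁻¹ ↔ p ∈ closedLatticePoints f L r s := by
  obtain ⟨j, k⟩ := p
  simp only [closedLatticePoints, Prod.swap_prod_mk, Set.mem_ofPred_eq]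
  have hx0 : 0 ≤ (j : ℝ) * s / r := by positivity
  have hy0 : 0 ≤ (k : ℝ) * s⁻¹ / r := by positivity
  have h1 : ∀ z : ℝ, (k : ℝ) ≤ r * s * z ↔ (k : ℝ) * s⁻¹ / r ≤ z := by
    intro z
    rw [div_le_iff₀ hr, ← div_eq_mul_inv, div_le_iff₀ hs]
    constructor <;> intro h <;> linarith
  have h2 : ∀ z : ℝ, (j : ℝ) ≤ r * s⁻¹ * z ↔ (j : ℝ) * s / r ≤ z := by
    intro z
    rw [div_le_iff₀ hr, ← le_div_iff₀ hs]
    rw [show z * r / s = r * s⁻¹ * z by rw [div_eq_mul_inv]; ring]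
  rw [h1, h2]
  constructor
  · rintro ⟨h3, h4⟩
    have hx : (j : ℝ) * s / r ∈ Set.Icc 0 L :=
      ⟨hx0, h4.trans (hΓ.curveInverse_mem ⟨hy0, h3⟩).2⟩
    exact ⟨hx.2, (hΓ.le_apply_iff hx ⟨hy0, h3⟩).2 h4⟩
  · rintro ⟨h3, h4⟩
    have hy : (k : ℝ) * s⁻¹ / r ∈ Set.Icc 0 M := ⟨hy0, h4.trans (hΓ.map_mem ⟨hx0, h3⟩).2⟩
    exact ⟨hy.2, (hΓ.le_apply_iff ⟨hx0, h3⟩ hy).1 h4⟩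

theorem closedCount_curveInverse (hΓ : IsConvexDecreasingCurve f L M) {r s : ℝ} (hr : 0 < r)
    (hs : 0 < s) : closedCount (curveInverse f L) M r s⁻¹ = closedCount f L r s := by
  have : closedLatticePoints f L r s =
      Prod.swap ⁻¹' closedLatticePoints (curveInverse f L) M r s⁻¹ := by
    ext p
    exact (hΓ.swap_mem_closedLatticePoints hr hs p).symm
  rw [closedCount, closedCount, this, ← Set.image_swap_eq_preimage_swap,
    Set.ncard_image_of_injective _ Prod.swap_injective]

end IsConvexDecreasingCurve

/-! ### The two-term expansion of the count -/

theorem ConvexDecreasing.le_closedCount {h : ℝ → ℝ} {ℓ r s : ℝ} (H : ConvexDecreasing h ℓ)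
    (hr : 0 < r) (hs : 0 < s) :
    (r ^ 2 * ∫ x in (0 : ℝ)..ℓ, h x) + r * s * h 0 / 2 ≤ closedCount h ℓ r s := by
  have hmem : ∀ j : ℕ, j ∈ range (⌊r * ℓ / s⌋₊ + 1) ↔ (j : ℝ) * s / r ≤ ℓ := by
    intro j
    have := H.pos
    rw [mem_range, Nat.lt_succ_iff, Nat.le_floor_iff (by positivity), le_div_iff₀ hs,
      div_le_iff₀ hr, mul_comm r]
  have h1 := ncard_natural_points_le (range (⌊r * ℓ / s⌋₊ + 1)) (fun j => r * s * h (j * s / r))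
    fun j hj => mul_nonneg (by positivity) (H.nonneg ⟨by positivity, (hmem j).1 hj⟩)
  have h2 : {p : ℕ × ℕ | p.1 ∈ range (⌊r * ℓ / s⌋₊ + 1) ∧ (p.2 : ℝ) ≤ r * s * h (p.1 * s / r)} =
      closedLatticePoints h ℓ r s := by
    ext p
    simp only [Set.mem_ofPred_eq, closedLatticePoints, hmem]
  rw [h2] at h1
  rw [closedCount, h1]
  exact H.le_sum_floor hr hs

/-- The lattice points are those of a box with corner on the curve, those to its right and those
above it. -/
theorem IsConvexDecreasingCurve.closedCount_eq {f : ℝ → ℝ} {L M : ℝ}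
    (hΓ : IsConvexDecreasingCurve f L M) {α : ℝ} (hα : α ∈ Set.Icc 0 L) {r s : ℝ} (hr : 0 < r)
    (hs : 0 < s) :
    closedCount f L r s = (⌊r * α / s⌋₊ + 1) * (⌊r * f α / s⁻¹⌋₊ + 1) +
      ∑ j ∈ Ioc ⌊r * α / s⌋₊ ⌊r * L / s⌋₊, (⌊r * s * f (j * s / r)⌋₊ + 1) +
      ∑ k ∈ Ioc ⌊r * f α / s⁻¹⌋₊ ⌊r * M / s⁻¹⌋₊,
        (⌊r * s⁻¹ * curveInverse f L (k * s⁻¹ / r)⌋₊ + 1) := by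
  set g := curveInverse f L with hg
  have hβ := hΓ.map_mem hα
  have H := hΓ.convexDecreasing
  have G := hΓ.convexDecreasing_curveInverse
  have hfl : ∀ {t : ℝ}, 0 < t → ∀ (n : ℕ) {z : ℝ}, 0 ≤ z → (n ≤ ⌊r * z / t⌋₊ ↔ n * t / r ≤ z) := by
    intro t ht n z hz
    rw [Nat.le_floor_iff (by positivity), le_div_iff₀ ht, div_le_iff₀ hr, mul_comm r]
  have hk : ∀ {t : ℝ}, 0 < t → ∀ (n : ℕ) (z : ℝ), (n : ℝ) ≤ r * t * z ↔ n * t⁻¹ / r ≤ z := by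
    intro t ht n z
    rw [div_le_iff₀ hr, ← div_eq_mul_inv, div_le_iff₀ ht]
    constructor <;> intro h <;> linarith
  have hs' : 0 < s⁻¹ := by positivity
  have hIoc : ∀ {t : ℝ}, 0 < t → ∀ (n : ℕ) {z w : ℝ}, 0 ≤ z → 0 ≤ w →
      (n ∈ Ioc ⌊r * z / t⌋₊ ⌊r * w / t⌋₊ ↔ z < n * t / r ∧ n * t / r ≤ w) := by
    intro t ht n z w hz hw
    rw [mem_Ioc, ← not_le, hfl ht n hz, hfl ht n hw, not_le]
  have hA := ncard_natural_points_le (range (⌊r * α / s⌋₊ + 1)) (fun _ => r * f α / s⁻¹)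
    (fun _ _ => by have := hβ.1; positivity)
  have hB := ncard_natural_points_le (Ioc ⌊r * α / s⌋₊ ⌊r * L / s⌋₊)
    (fun j => r * s * f (j * s / r)) (fun j hj => mul_nonneg (by positivity)
      (H.nonneg ⟨by positivity, ((hIoc hs j hα.1 H.pos.le).1 hj).2⟩))
  have hC := ncard_natural_points_le (Ioc ⌊r * f α / s⁻¹⌋₊ ⌊r * M / s⁻¹⌋₊)
    (fun k => r * s⁻¹ * g (k * s⁻¹ / r)) (fun k hk => mul_nonneg (by positivity)
      (G.nonneg ⟨by positivity, ((hIoc hs' k hβ.1 G.pos.le).1 hk).2⟩))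
  set A := {p : ℕ × ℕ | p.1 ∈ range (⌊r * α / s⌋₊ + 1) ∧ (p.2 : ℝ) ≤ r * f α / s⁻¹} with hAdef
  set B := {p : ℕ × ℕ | p.1 ∈ Ioc ⌊r * α / s⌋₊ ⌊r * L / s⌋₊ ∧
    (p.2 : ℝ) ≤ r * s * f (p.1 * s / r)} with hBdef
  set C := {p : ℕ × ℕ | p.1 ∈ Ioc ⌊r * f α / s⁻¹⌋₊ ⌊r * M / s⁻¹⌋₊ ∧
    (p.2 : ℝ) ≤ r * s⁻¹ * g (p.1 * s⁻¹ / r)} with hCdef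
  have mA : ∀ j k : ℕ, (j, k) ∈ A ↔ j * s / r ≤ α ∧ k * s⁻¹ / r ≤ f α := by
    intro j k
    simp only [hAdef, Set.mem_ofPred_eq]
    rw [mem_range, Nat.lt_succ_iff, hfl hs j hα.1, le_div_iff₀ hs', mul_comm r (f α),
      ← div_le_iff₀ hr]
  have mB : ∀ j k : ℕ, (j, k) ∈ B ↔
      (α < j * s / r ∧ j * s / r ≤ L) ∧ k * s⁻¹ / r ≤ f (j * s / r) := by
    intro j k
    simp only [hBdef, Set.mem_ofPred_eq]
    rw [hIoc hs j hα.1 H.pos.le, hk hs]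
  have mC : ∀ j k : ℕ, (j, k) ∈ Prod.swap '' C ↔
      (f α < k * s⁻¹ / r ∧ k * s⁻¹ / r ≤ M) ∧ j * s / r ≤ g (k * s⁻¹ / r) := by
    intro j k
    rw [Set.image_swap_eq_preimage_swap]
    simp only [hCdef, Set.mem_preimage, Prod.swap_prod_mk, Set.mem_ofPred_eq]
    rw [hIoc hs' k hβ.1 G.pos.le, hk hs', inv_inv]
  have mX : ∀ j k : ℕ, (j, k) ∈ closedLatticePoints f L r s ↔
      j * s / r ≤ L ∧ k * s⁻¹ / r ≤ f (j * s / r) := by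
    intro j k
    simp only [closedLatticePoints, Set.mem_ofPred_eq]
    rw [hk hs]
  have hx0 : ∀ j : ℕ, 0 ≤ (j : ℝ) * s / r := fun j => by positivity
  have hy0 : ∀ k : ℕ, 0 ≤ (k : ℝ) * s⁻¹ / r := fun k => by positivity
  have hX : closedLatticePoints f L r s = A ∪ B ∪ Prod.swap '' C := by
    ext ⟨j, k⟩
    rw [Set.mem_union, Set.mem_union, mA, mB, mC, mX]
    constructor
    · rintro ⟨h1, h2⟩
      rcases lt_or_ge α (j * s / r) with h3 | h3
      · exact Or.inl (Or.inr ⟨⟨h3, h1⟩, h2⟩)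
      rcases lt_or_ge (f α) (k * s⁻¹ / r) with h4 | h4
      · have h5 : (k : ℝ) * s⁻¹ / r ∈ Set.Icc 0 M :=
          ⟨hy0 k, h2.trans (hΓ.map_mem ⟨hx0 j, h1⟩).2⟩
        exact Or.inr ⟨⟨h4, h5.2⟩, (hΓ.le_apply_iff ⟨hx0 j, h1⟩ h5).1 h2⟩
      · exact Or.inl (Or.inl ⟨h3, h4⟩)
    · rintro ((⟨h1, h2⟩ | ⟨⟨-, h1⟩, h2⟩) | ⟨⟨-, h1⟩, h2⟩)
      · have h3 : (j : ℝ) * s / r ∈ Set.Icc 0 L := ⟨hx0 j, h1.trans hα.2⟩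
        exact ⟨h3.2, h2.trans (H.antitoneOn h3 hα h1)⟩
      · exact ⟨h1, h2⟩
      · have h3 : (j : ℝ) * s / r ∈ Set.Icc 0 L :=
          ⟨hx0 j, h2.trans (hΓ.curveInverse_mem ⟨hy0 k, h1⟩).2⟩
        exact ⟨h3.2, (hΓ.le_apply_iff h3 ⟨hy0 k, h1⟩).2 h2⟩
  have hfin := closedLatticePoints_finite hΓ hr hs
  rw [hX] at hfin
  have hfAB := hfin.subset Set.subset_union_left
  have d1 : Disjoint A B := by
    rw [Set.disjoint_left]
    rintro ⟨j, k⟩ h1 h2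
    rw [mA] at h1
    rw [mB] at h2
    linarith [h1.1, h2.1.1]
  have d2 : Disjoint (A ∪ B) (Prod.swap '' C) := by
    rw [Set.disjoint_left]
    rintro ⟨j, k⟩ h1 h2
    rw [Set.mem_union, mA, mB] at h1
    rw [mC] at h2
    rcases h1 with h1 | h1
    · linarith [h1.2, h2.1.1]
    · have := H.antitoneOn hα ⟨hx0 j, h1.1.2⟩ h1.1.1.le
      linarith [h1.2, h2.1.1]
  rw [closedCount, hX, Set.ncard_union_eq d2 hfAB (hfin.subset Set.subset_union_right),
    Set.ncard_union_eq d1 (hfAB.subset Set.subset_union_left)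
      (hfAB.subset Set.subset_union_right), Set.ncard_image_of_injective _ Prod.swap_injective,
    hA, hB, hC, sum_const, card_range, smul_eq_mul]

/-- With `a = r α / s` and `b = r s f(α)`, the box has `ab + (a + b)/2 - sawtooth a * b - sawtooth b
* a + O(1)` points. The columns contribute `sawtooth a * b` and the rows `sawtooth b * a`, so these
terms of order `r` cancel, and the halves assemble to `r(L/s + sM)/2`. -/
theorem IsConvexDecreasingCurve.abs_closedCount_sub_le {f : ℝ → ℝ} {L M : ℝ}
    (hΓ : IsConvexDecreasingCurve f L M) {α : ℝ} (hα : 0 < α) (hαL : α < L) {r s : ℝ} (hr : 0 < r)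
    (hs : 0 < s) :
    |(closedCount f L r s : ℝ) - (r ^ 2 * curveArea f L + r * (L / s + s * M) / 2)| ≤
      |∑ j ∈ Ioc ⌊r * α / s⌋₊ ⌊r * L / s⌋₊, sawtooth (r * s * f (j * s / r))| +
      |∑ k ∈ Ioc ⌊r * f α / s⁻¹⌋₊ ⌊r * M / s⁻¹⌋₊,
        sawtooth (r * s⁻¹ * curveInverse f L (k * s⁻¹ / r))| +
      (3 + 2 * (s ^ 2 * ((M - f α) / α)) + 2 * (s⁻¹ ^ 2 * ((L - α) / f α))) := by
  have hα' : α ∈ Set.Icc 0 L := ⟨hα.le, hαL.le⟩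
  have hβ := hΓ.map_mem hα'
  have hβ0 : 0 < f α := by
    rw [← hΓ.right]; exact hΓ.strictAntiOn hα' ⟨hΓ.pos.le, le_rfl⟩ hαL
  have H := hΓ.convexDecreasing
  have G := hΓ.convexDecreasing_curveInverse
  have hs' : 0 < s⁻¹ := by positivity
  have h1 := H.abs_sum_floor_sub_le hr hs hα hαL.le
    (K := (f 0 - f α) / α) (div_nonneg (by rw [hΓ.left]; linarith [hβ.2]) hα.le)
    (fun x y h1 h2 h3 => H.convexOn.sub_le_of_antitoneOn hα h1 h2 h3)
  have h2 := G.abs_sum_floor_sub_le hr hs' hβ0 hβ.2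
    (K := (curveInverse f L 0 - curveInverse f L (f α)) / f α)
    (div_nonneg (by rw [hΓ.curveInverse_zero, hΓ.curveInverse_apply hα']; linarith) hβ0.le)
    (fun x y h1 h2 h3 => G.convexOn.sub_le_of_antitoneOn hβ0 h1 h2 h3)
  rw [hΓ.curveInverse_zero, hΓ.curveInverse_apply hα'] at h2
  rw [hΓ.left] at h1
  rw [hΓ.closedCount_eq hα' hr hs, hΓ.curveArea_eq hα', Nat.cast_add, Nat.cast_add]
  set a := r * α / s with ha
  set b := r * f α / s⁻¹ with hb
  have ha0 : 0 ≤ a := by positivity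
  have hb0 : 0 ≤ b := by positivity
  have e1 : (⌊a⌋₊ : ℝ) + 1 = a + 1 / 2 - sawtooth a := by
    rw [sawtooth, ← Int.self_sub_floor, natCast_floor_eq_intCast_floor ha0]; ring
  have e2 : (⌊b⌋₊ : ℝ) + 1 = b + 1 / 2 - sawtooth b := by
    rw [sawtooth, ← Int.self_sub_floor, natCast_floor_eq_intCast_floor hb0]; ring
  have e3 : r * s * f α = b := by rw [hb, div_inv_eq_mul]; ring
  have e4 : r * s⁻¹ * α = a := by rw [ha, div_eq_mul_inv]; ring
  have e5 : a * b = r ^ 2 * (α * f α) := by rw [ha, hb]; field_simp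
  have e6 : r * (L / s + s * M) = r * L / s + r * M / s⁻¹ := by rw [div_inv_eq_mul]; ring
  rw [e3] at h1
  rw [e4] at h2
  rw [e6]
  push_cast
  push_cast at h1 h2
  rw [e1, e2]
  have p1 := abs_le.1 (abs_sawtooth_le a)
  have p2 := abs_le.1 (abs_sawtooth_le b)
  have p3 : 0 ≤ (1 / 2 - sawtooth a) * (1 / 2 - sawtooth b) :=
    mul_nonneg (by linarith) (by linarith)
  have p4 : (1 / 2 - sawtooth a) * (1 / 2 - sawtooth b) ≤ 1 * 1 :=
    mul_le_mul (by linarith) (by linarith) (by linarith) zero_le_one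
  have q1 := abs_le.1 h1
  have q2 := abs_le.1 h2
  have e7 : (a + 1 / 2 - sawtooth a) * (b + 1 / 2 - sawtooth b) = r ^ 2 * (α * f α) +
      (a + b) / 2 - sawtooth a * b - sawtooth b * a +
        (1 / 2 - sawtooth a) * (1 / 2 - sawtooth b) := by rw [← e5]; ring
  rw [e7, abs_le]
  constructor <;> linarith

/-! ### The error exponent and the optimal stretch factors -/

/-- Cutting at `y = b - δ r` gives errors of exponent `2/3`, `1 - 2a₂` and `1 - 2a₁`; the first is
at most `1 - 2e` because `e ≤ 1/6`. -/
theorem IsRegularTail.eventually_abs_sum_sawtooth_le {h : ℝ → ℝ} {a b : ℝ}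
    (H : IsRegularTail h a b) (ha : 0 < a) (hab : a < b) {K : ℝ} (hK0 : 0 ≤ K)
    (hK : ∀ x ∈ Set.Icc a b, ∀ y ∈ Set.Icc a b, |h x - h y| ≤ K * |x - y|)
    {δ : ℝ → ℝ} (hδ : ∀ r : ℝ, 0 < r → δ r ∈ Set.Ioo 0 (b / 2 - a)) {a₁ a₂ e : ℝ}
    (hδO : δ =O[Filter.atTop] (fun r : ℝ => r ^ (-2 * a₁)))
    (hO : (fun r : ℝ => 1 / secondDeriv h a b (b - δ r))
      =O[Filter.atTop] (fun r : ℝ => r ^ (1 - 4 * a₂)))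
    (he : e ≤ 1 / 6) (he1 : e ≤ a₁) (he2 : e ≤ a₂) :
    ∃ C, 0 ≤ C ∧ ∀ᶠ r : ℝ in Filter.atTop, ∀ s : ℝ, 1 / 3 ≤ s → s ≤ 3 →
      |∑ n ∈ Ioc ⌊r * a / s⌋₊ ⌊r * b / s⌋₊, sawtooth (r * s * h (n * s / r))| ≤
        C * r ^ (1 - 2 * e) := by
  obtain ⟨C, hC0, hC⟩ := H.exists_abs_sum_sawtooth_le ha.le hab hK0 hK
  obtain ⟨C₁, hC₁, hδO⟩ := hδO.exists_pos
  obtain ⟨C₂, hC₂, hO⟩ := hO.exists_pos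
  refine ⟨C * (1 + √C₂ + C₁), by positivity, ?_⟩
  filter_upwards [hδO.bound, hO.bound, Filter.eventually_ge_atTop 1] with r h1 h2 hr s hs hs3
  have hr0 : 0 < r := by linarith
  obtain ⟨hd0, hd1⟩ := hδ r hr0
  refine (hC r s (b - δ r) hr hs hs3 (by linarith) (by linarith)).trans ?_
  rw [mul_assoc C]
  refine mul_le_mul_of_nonneg_left ?_ hC0
  rw [Real.norm_eq_abs, Real.norm_eq_abs, abs_of_pos hd0, abs_of_pos (by positivity)] at h1
  rw [Real.norm_eq_abs, Real.norm_eq_abs, abs_of_pos (Real.rpow_pos_of_pos hr0 _)] at h2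
  have t1 : r ^ (2 / 3 : ℝ) ≤ r ^ (1 - 2 * e) :=
    Real.rpow_le_rpow_of_exponent_le hr (by linarith)
  have t2 : r * (b - (b - δ r)) ≤ C₁ * r ^ (1 - 2 * e) := by
    calc r * (b - (b - δ r)) = r * δ r := by ring
      _ ≤ r * (C₁ * r ^ (-2 * a₁)) := by gcongr
      _ = C₁ * r ^ (1 + -2 * a₁) := by rw [Real.rpow_add hr0, Real.rpow_one]; ring
      _ ≤ C₁ * r ^ (1 - 2 * e) := by
        gcongr
        linarith
  have t3 : √r * √(1 / secondDeriv h a b (b - δ r)) ≤ √C₂ * r ^ (1 - 2 * e) := by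
    have h3 : √(1 / secondDeriv h a b (b - δ r)) ≤ √(C₂ * r ^ (1 - 4 * a₂)) :=
      Real.sqrt_le_sqrt ((le_abs_self _).trans h2)
    calc √r * √(1 / secondDeriv h a b (b - δ r)) ≤ √r * √(C₂ * r ^ (1 - 4 * a₂)) := by gcongr
      _ = √C₂ * r ^ (1 - 2 * a₂) := by
        rw [Real.sqrt_mul hC₂.le, Real.sqrt_eq_rpow r, Real.sqrt_eq_rpow (r ^ (1 - 4 * a₂)),
          ← Real.rpow_mul hr0.le, mul_left_comm, ← Real.rpow_add hr0]
        congr 2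
        ring
      _ ≤ √C₂ * r ^ (1 - 2 * e) := by
        gcongr
  linarith

theorem optimalStretch_nonempty (f : ℝ → ℝ) (L r : ℝ) : (optimalStretch f L r).Nonempty := by
  have hne : (closedCount f L r '' Set.Ioi 0).Nonempty := ⟨_, 1, Set.mem_Ioi.2 one_pos, rfl⟩
  obtain ⟨s, hs, h⟩ := Nat.sInf_mem hne
  exact ⟨s, hs, fun t ht => h.trans_le (Nat.sInf_le ⟨t, ht, rfl⟩)⟩

theorem minClosedCount_eq {f : ℝ → ℝ} {L r s : ℝ} (hs : s ∈ optimalStretch f L r) :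
    minClosedCount f L r = closedCount f L r s := by
  refine le_antisymm (Nat.sInf_le ⟨s, hs.1, rfl⟩) ?_
  refine le_csInf ⟨_, s, hs.1, rfl⟩ ?_
  rintro _ ⟨t, ht, rfl⟩
  exact hs.2 t ht

theorem ConvexDecreasing.abs_sub_le {h : ℝ → ℝ} {ℓ a : ℝ} (H : ConvexDecreasing h ℓ) (ha : 0 < a)
    {x y : ℝ} (hx : x ∈ Set.Icc a ℓ) (hy : y ∈ Set.Icc a ℓ) :
    |h x - h y| ≤ (h 0 - h a) / a * |x - y| := by
  have key : ∀ {x y : ℝ}, x ∈ Set.Icc a ℓ → y ∈ Set.Icc a ℓ → x ≤ y →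
      |h x - h y| ≤ (h 0 - h a) / a * |x - y| := by
    intro x y hx hy hxy
    have := H.antitoneOn ⟨ha.le.trans hx.1, hx.2⟩ ⟨ha.le.trans hy.1, hy.2⟩ hxy
    rw [abs_of_nonneg (by linarith), abs_sub_comm x y, abs_of_nonneg (by linarith)]
    exact H.convexOn.sub_le_of_antitoneOn ha hx.1 hxy hy.2
  rcases le_total x y with hxy | hxy
  · exact key hx hy hxy
  · rw [abs_sub_comm (h x), abs_sub_comm x]
    exact key hy hx hxy

/-- If the counting function has the two-term asymptotics of a convex curve with equal intercepts,
uniformly for bounded stretch factors, then the optimal stretch factors tend to `1`. -/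
theorem optimalStretch_of_asymptotics {f : ℝ → ℝ} {L A C e : ℝ} (hL : 0 < L) (he0 : 0 < e)
    (hC0 : 0 ≤ C)
    (hasymp : ∀ᶠ r : ℝ in Filter.atTop, ∀ s : ℝ, 1 / 3 ≤ s → s ≤ 3 →
      |(closedCount f L r s : ℝ) - (r ^ 2 * A + r * (L / s + s * L) / 2)| ≤ C * r ^ (1 - 2 * e))
    (hlow : ∀ r s : ℝ, 0 < r → 0 < s → r ^ 2 * A + r * s * L / 2 ≤ closedCount f L r s ∧
      r ^ 2 * A + r * s⁻¹ * L / 2 ≤ closedCount f L r s) :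
    ∃ D : ℝ, 0 ≤ D ∧ ∀ᶠ r : ℝ in Filter.atTop,
      (∀ s ∈ optimalStretch f L r, |s - 1| ≤ D * r ^ (-e)) ∧
      |(minClosedCount f L r : ℝ) - (r ^ 2 * A + r * L)| ≤ C * r ^ (1 - 2 * e) := by
  have hlim : Filter.Tendsto (fun r : ℝ => C * r ^ (-(2 * e))) Filter.atTop (nhds 0) := by
    have := (tendsto_rpow_neg_atTop (y := 2 * e) (by linarith)).const_mul C
    rwa [mul_zero] at this
  refine ⟨√(12 * C / L), Real.sqrt_nonneg _, ?_⟩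
  filter_upwards [hasymp, Filter.eventually_gt_atTop 0,
    hlim.eventually (gt_mem_nhds (by positivity : 0 < L / 2))] with r h1 hr hsmall
  have hpow : r ^ (1 - 2 * e) = r * r ^ (-(2 * e)) := by
    rw [sub_eq_add_neg, Real.rpow_add hr, Real.rpow_one]
  set q := r ^ (-(2 * e)) with hq
  have hq0 : 0 < q := Real.rpow_pos_of_pos hr _
  have hqe : q = r ^ (-e) * r ^ (-e) := by
    rw [hq, ← Real.rpow_add hr]; congr 1; ring
  rw [hpow] at h1 ⊢
  have hone := abs_le.1 (h1 1 (by norm_num) (by norm_num))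
  rw [div_one, one_mul] at hone
  -- At `s = 1` the count is at most `r²A + rL + rL/2`. Against the lower bounds `r²A + rsL/2` and
  -- `r²A + rL/(2s)`, this yields the factor 3.
  have hrange : ∀ s ∈ optimalStretch f L r, 1 / 3 ≤ s ∧ s ≤ 3 := by
    rintro s ⟨hs, hopt⟩
    have h2 : (closedCount f L r s : ℝ) ≤ closedCount f L r 1 := by exact_mod_cast hopt 1 one_pos
    obtain ⟨h3, h4⟩ := hlow r s hr hs
    have h5 : C * (r * q) ≤ r * (L / 2) := by
      have := mul_le_mul_of_nonneg_left hsmall.le hr.le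
      linarith
    have h6 : r * L * s ≤ r * L * 3 := by linarith [hone.2]
    have h7 : r * L * s⁻¹ ≤ r * L * 3 := by linarith [hone.2]
    have hrL : 0 < r * L := by positivity
    refine ⟨?_, le_of_mul_le_mul_left h6 hrL⟩
    have h8 := le_of_mul_le_mul_left h7 hrL
    rw [one_div]
    exact inv_le_of_inv_le₀ hs h8
  have hgap : ∀ s : ℝ, 0 < s → L / s + s * L = 2 * L + L * ((s - 1) ^ 2 / s) := by
    intro s hs
    field_simp
    ring
  refine ⟨?_, ?_⟩
  · intro s hs
    obtain ⟨hs1, hs3⟩ := hrange s hs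
    have hs0 : 0 < s := hs.1
    have h2 : (closedCount f L r s : ℝ) ≤ closedCount f L r 1 := by
      exact_mod_cast hs.2 1 one_pos
    have h3 := (abs_le.1 (h1 s hs1 hs3)).1
    rw [hgap s hs0] at h3
    -- The error `C r q` occurs twice, at `s` and at `1`, and the linear term carries a factor
    -- `1/2`, whence 4; `s ≤ 3` then gives the 12.
    have h4 : r * (L * ((s - 1) ^ 2 / s)) ≤ r * (4 * C * q) := by linarith [hone.2]
    have h5 := le_of_mul_le_mul_left h4 hr
    have h6 : (s - 1) ^ 2 ≤ 12 * C / L * q := by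
      rw [mul_div_assoc', div_le_iff₀ hs0] at h5
      rw [div_mul_eq_mul_div, le_div_iff₀ hL]
      have h7 : 4 * C * q * s ≤ 4 * C * q * 3 := mul_le_mul_of_nonneg_left hs3 (by positivity)
      linarith
    have h7 : (s - 1) ^ 2 ≤ (√(12 * C / L) * r ^ (-e)) ^ 2 := by
      rw [mul_pow, Real.sq_sqrt (by positivity), pow_two (r ^ (-e)), ← hqe]
      exact h6
    exact abs_le_of_sq_le_sq h7 (by positivity)
  · obtain ⟨s, hs⟩ := optimalStretch_nonempty f L r
    obtain ⟨hs1, hs3⟩ := hrange s hs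
    have hs0 : 0 < s := hs.1
    have h2 : (closedCount f L r s : ℝ) ≤ closedCount f L r 1 := by
      exact_mod_cast hs.2 1 one_pos
    have h3 := (abs_le.1 (h1 s hs1 hs3)).1
    rw [hgap s hs0] at h3
    have h4 : 0 ≤ r * (L * ((s - 1) ^ 2 / s)) := by positivity
    rw [minClosedCount_eq hs, abs_le]
    constructor <;> linarith [hone.2]

theorem mainTheorem2 (f : ℝ → ℝ) (L M α β : ℝ)
    (hΓ : IsConvexDecreasingCurve f L M)
    (hα : 0 < α) (hαL : α < L / 2) (hβ : f α = β) (hβM : β < M / 2)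
    (hf : IsRegularTail f α L)
    (hg : IsRegularTail (curveInverse f L) β M)
    (δ ε : ℝ → ℝ)
    (hδ : ∀ r : ℝ, 0 < r → δ r ∈ Set.Ioo 0 (L / 2 - α))
    (hε : ∀ r : ℝ, 0 < r → ε r ∈ Set.Ioo 0 (M / 2 - β))
    (a₁ a₂ b₁ b₂ : ℝ) (ha₁ : 0 < a₁) (ha₂ : 0 < a₂) (hb₁ : 0 < b₁) (hb₂ : 0 < b₂)
    (hδO : δ =O[Filter.atTop] (fun r : ℝ => r ^ (-2 * a₁)))
    (hfO : (fun r : ℝ => 1 / secondDeriv f α L (L - δ r))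
      =O[Filter.atTop] (fun r : ℝ => r ^ (1 - 4 * a₂)))
    (hεO : ε =O[Filter.atTop] (fun r : ℝ => r ^ (-2 * b₁)))
    (hgO : (fun r : ℝ => 1 / secondDeriv (curveInverse f L) β M (M - ε r))
      =O[Filter.atTop] (fun r : ℝ => r ^ (1 - 4 * b₂)))
    (hLM : L = M)
    (e : ℝ) (he : e = min (1 / 6) (min a₁ (min a₂ (min b₁ b₂)))) :
    -- for every `r > 0` the minimum is attained
    (∀ r : ℝ, 0 < r → (optimalStretch f L r).Nonempty) ∧
    -- the optimal stretch factors approach `1`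
    (∀ η : ℝ, 0 < η → ∀ᶠ r : ℝ in Filter.atTop,
      ∀ s ∈ optimalStretch f L r, |s - 1| < η) ∧
    -- with rate `O(r ^ (-e))`
    (∃ C : ℝ, ∀ᶠ r : ℝ in Filter.atTop,
      optimalStretch f L r ⊆ Set.Icc (1 - C * r ^ (-e)) (1 + C * r ^ (-e))) ∧
    -- asymptotic formula for the minimal lattice count
    ((fun r : ℝ => (minClosedCount f L r : ℝ) - (r ^ 2 * curveArea f L + r * L))
      =O[Filter.atTop] (fun r : ℝ => r ^ (1 - 2 * e))) := by
  have hL := hΓ.pos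
  have hαL' : α < L := by linarith
  have hα' : α ∈ Set.Icc 0 L := ⟨hα.le, hαL'.le⟩
  have hβ0 : 0 < β := by
    rw [← hβ, ← hΓ.right]; exact hΓ.strictAntiOn hα' ⟨hL.le, le_rfl⟩ hαL'
  have hβM' : β < M := by linarith [hΓ.height_pos]
  have he0 : 0 < e := by
    rw [he]; exact lt_min (by norm_num) (lt_min ha₁ (lt_min ha₂ (lt_min hb₁ hb₂)))
  obtain ⟨e6, e1, e2, e3, e4⟩ : e ≤ 1 / 6 ∧ e ≤ a₁ ∧ e ≤ a₂ ∧ e ≤ b₁ ∧ e ≤ b₂ := by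
    have := he.le
    simpa only [le_min_iff] using this
  have H := hΓ.convexDecreasing
  have G := hΓ.convexDecreasing_curveInverse
  have hKf : 0 ≤ (f 0 - f α) / α :=
    div_nonneg (by linarith [H.antitoneOn ⟨le_rfl, hL.le⟩ hα' hα.le]) hα.le
  have hKg : 0 ≤ (curveInverse f L 0 - curveInverse f L β) / β :=
    div_nonneg (by linarith [G.antitoneOn ⟨le_rfl, hΓ.height_pos.le⟩ ⟨hβ0.le, hβM'.le⟩ hβ0.le])
      hβ0.le
  obtain ⟨C₁, hC₁, h1⟩ := hf.eventually_abs_sum_sawtooth_le hα hαL' hKf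
    (fun x hx y hy => H.abs_sub_le hα hx hy) hδ hδO hfO e6 e1 e2
  obtain ⟨C₂, hC₂, h2⟩ := hg.eventually_abs_sum_sawtooth_le hβ0 hβM' hKg
    (fun x hx y hy => G.abs_sub_le hβ0 hx hy) hε hεO hgO e6 e3 e4
  -- The bounded part of the error, with `s² ≤ 9` and `s⁻² ≤ 9`; the range `[1/3, 3]` is stable
  -- under inversion, as the rows need.
  set c := 3 + 18 * ((M - f α) / α) + 18 * ((L - α) / f α) with hc
  have hMf : 0 ≤ (M - f α) / α := by rw [← hΓ.left]; exact hKf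
  have hLf : 0 ≤ (L - α) / f α := div_nonneg (by linarith) (hΓ.map_mem hα').1
  have hc0 : 0 ≤ c := by positivity
  have hasymp : ∀ᶠ r : ℝ in Filter.atTop, ∀ s : ℝ, 1 / 3 ≤ s → s ≤ 3 →
      |(closedCount f L r s : ℝ) - (r ^ 2 * curveArea f L + r * (L / s + s * L) / 2)| ≤
        (C₁ + C₂ + c) * r ^ (1 - 2 * e) := by
    filter_upwards [h1, h2, Filter.eventually_ge_atTop 1] with r h1 h2 hr s hs hs3
    have hs0 : 0 < s := by linarith
    have hsi : 1 / 3 ≤ s⁻¹ := by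
      rw [one_div]; exact inv_anti₀ hs0 hs3
    have hsi3 : s⁻¹ ≤ 3 := by
      rw [one_div] at hs
      exact inv_le_of_inv_le₀ (by norm_num) hs
    have h3 := hΓ.abs_closedCount_sub_le hα hαL' (by linarith : 0 < r) hs0
    rw [← hLM] at h3 h2 hc
    have h4 := h1 s hs hs3
    have h5 := h2 s⁻¹ hsi hsi3
    rw [← hβ] at h5
    have h6 : 1 ≤ r ^ (1 - 2 * e) := Real.one_le_rpow hr (by linarith)
    rw [← hLM] at hMf
    have h7 : s ^ 2 * ((L - f α) / α) ≤ 9 * ((L - f α) / α) := by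
      have : s ^ 2 ≤ 9 := by nlinarith
      gcongr
    have h8 : s⁻¹ ^ 2 * ((L - α) / f α) ≤ 9 * ((L - α) / f α) := by
      have h0 : 0 < s⁻¹ := by positivity
      have : s⁻¹ ^ 2 ≤ 9 := by nlinarith
      gcongr
    have h9 : c ≤ c * r ^ (1 - 2 * e) := le_mul_of_one_le_right hc0 h6
    linarith
  have hlow : ∀ r s : ℝ, 0 < r → 0 < s →
      r ^ 2 * curveArea f L + r * s * L / 2 ≤ closedCount f L r s ∧
      r ^ 2 * curveArea f L + r * s⁻¹ * L / 2 ≤ closedCount f L r s := by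
    intro r s hr hs
    have h3 := H.le_closedCount hr hs
    have h4 := G.le_closedCount hr (inv_pos.2 hs)
    rw [hΓ.left, ← hLM] at h3
    rw [hΓ.closedCount_curveInverse hr hs, hΓ.integral_curveInverse, hΓ.curveInverse_zero] at h4
    exact ⟨h3, h4⟩
  obtain ⟨D, hD, hfinal⟩ := optimalStretch_of_asymptotics hL he0 (by positivity) hasymp hlow
  refine ⟨fun r _ => optimalStretch_nonempty f L r, ?_, ⟨D, ?_⟩, ?_⟩
  · intro η hη
    have hlim : Filter.Tendsto (fun r : ℝ => D * r ^ (-e)) Filter.atTop (nhds 0) := by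
      have := (tendsto_rpow_neg_atTop he0).const_mul D
      rwa [mul_zero] at this
    filter_upwards [hfinal, hlim.eventually (gt_mem_nhds hη)] with r h3 h4 s hs
    exact (h3.1 s hs).trans_lt h4
  · filter_upwards [hfinal] with r h3 s hs
    have := abs_le.1 (h3.1 s hs)
    exact ⟨by linarith, by linarith⟩
  · refine Asymptotics.IsBigO.of_bound (C₁ + C₂ + c) ?_
    filter_upwards [hfinal, Filter.eventually_gt_atTop 0] with r h3 hr
    rw [Real.norm_eq_abs, Real.norm_eq_abs, abs_of_pos (Real.rpow_pos_of_pos hr _)]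
    exact h3.2
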